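/- Let $T=\mathrm{Th}(\mathbb R,+,[0,1])$, where $[0,1]$ is named by a unary predicate $I$. Then $T$ has NIP and is unstable. Let $\mathcal M^*=(\mathbb R^*,+,I^*)$ be a monster model of $T$, i.e. a $\kappa$-saturated and strongly $\kappa$-homogeneous model, where $\kappa>|T|$ is a strong limit cardinal. "Small" and "bounded" mean of cardinality $<\kappa$. Put $G^*=(\mathbb R^*,+)$ and $\mu=\bigcap_{n\ge 1}[-1/n,1/n]^*$ (the infinitesimals), where $[-1/n,1/n]^*$ is the set defined in $\mathcal M^*$ by the formula $I(nx)\vee I(-nx)$, which defines $[-1/n,1/n]$ in $(\mathbb R,+,[0,1])$. A subset of $G^*$ is $\bigwedge$-definable over $A$ if it is an intersection of $A$-definable sets. For a subgroup $H\le G^*$ that is $\bigwedge$-definable over a small set $A$, the quotient $G^*/H$ is stable (over $A$) if for every $A$-indiscernible sequence $(a_i,b_i)_{i<\omega}$ with $a_i\in G^*/H$ and $b_i$ small tuples from $\mathcal M^*$, one has $\mathrm{tp}(a_i,b_j/A)=\mathrm{tp}(a_j,b_i/A)$ for all $i\neq j$; here types over $A$ are orbits of $\mathrm{Aut}(\mathcal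 M^*/A)$. Let * $G^{*st}$ be the intersection of all subgroups $H$ that are $\bigwedge$-definable over a small set and have $G^*/H$ stable; * $G^{*st,0}$ be the intersection of all definable (with parameters) subgroups $H$ with $G^*/H$ stable; * $G^{*0}$, $G^{*00}$, $G^{*000}$ be the intersections of all subgroups of bounded index that are, respectively, definable with parameters, $\bigwedge$-definable over a small set, invariant over a small set. Then: 1. $\mu$ is a subgroup of $G^*$, it is $\bigwedge$-definable over a small set with $G^*/\mu$ stable, and it is contained in every subgroup $H$ that is $\bigwedge$-definable over a small set with $G^*/H$ stable. Thus $G^{*st}=\mu$. 2. $G^*$ is the only (hence the smallest) subgroup of $G^*$ of bounded index that is $\bigwedge$-definable over a small set, and $G^{*0}=G^{*00}=G^{*000}=G^*$. 3. $G^{*st,0}=G^*$. 4. Consequently $G^{*st,0}\neq G^{*st}\neq G^{*00}=G^*$, and $G^{*st}$ is not an intersection of any family of subgroups of $G^*$ definable with parameters. -/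

import Mathlib

open FirstOrder FirstOrder.Language Cardinal

universe u v w

/-! ### Model-theoretic notions -/

namespace StableQuot

section Theories

variable {L : FirstOrder.Language.{u, v}}

/-- A theory has NIP: no formula `φ(x; y)` (with finite tuples `x`, `y`) has the independence
property, i.e. in no model are there `(a i)` and `(b S)`, for `i < ω` and `S ⊆ ω`, such that
`φ(a i; b S)` holds iff `i ∈ S`. -/
def HasNIP (T : L.Theory) : Prop :=
  ∀ (m n : ℕ) (φ : L.Formula (Fin m ⊕ Fin n)) (N : Theory.ModelType.{u, v, max u v} T),
    ¬ ∃ (a : ℕ → Fin m → N) (b : Set ℕ → Fin n → N),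
      ∀ (i : ℕ) (S : Set ℕ), φ.Realize (Sum.elim (a i) (b S)) ↔ i ∈ S

/-- A theory is stable: no formula `φ(x; y)` has the order property, i.e. in no model are there
`(a i)` and `(b i)`, for `i < ω`, such that `φ(a i; b j)` holds iff `i < j`. -/
def IsStableTheory (T : L.Theory) : Prop :=
  ∀ (m n : ℕ) (φ : L.Formula (Fin m ⊕ Fin n)) (N : Theory.ModelType.{u, v, max u v} T),
    ¬ ∃ (a : ℕ → Fin m → N) (b : ℕ → Fin n → N),
      ∀ i j : ℕ, φ.Realize (Sum.elim (a i) (b j)) ↔ i < j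

end Theories

section Monster

variable (L : FirstOrder.Language.{u, v}) (M : Type w) [L.Structure M] (κ : Cardinal.{w})

/-- `κ`-saturation: if `A` has fewer than `κ` elements, then every family of `A`-definable
subsets of `M` with the finite intersection property (that is, every finitely satisfiable set of
formulas over `A` in one variable) has a common element. -/
def IsSaturated : Prop :=
  ∀ A : Set M, #A < κ → ∀ S : Set (Set M), (∀ s ∈ S, A.Definable₁ L s) →
    (∀ F : Finset (Set M), (F : Set (Set M)) ⊆ S → (⋂₀ (F : Set (Set M))).Nonempty) →
    (⋂₀ S).Nonempty

/-- Strong `κ`-homogeneity: every partial elementary map whose domain has fewer than `κ` elements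
extends to an automorphism. -/
def IsStronglyHomogeneous : Prop :=
  ∀ (A : Set M) (f : A → M), #A < κ →
    (∀ φ : L.Formula A, φ.Realize (fun a : A => (a : M)) ↔ φ.Realize f) →
    ∃ σ : M ≃[L] M, ∀ a : A, σ (a : M) = f a

/-- `M` is a monster model with respect to `κ` (of its own complete theory): `κ` is a strong limit
cardinal greater than the cardinality `max ℵ₀ L.card` of the theory, and `M` is `κ`-saturated and
strongly `κ`-homogeneous. A set is called small when it has fewer than `κ` elements. -/
structure IsMonster : Prop where
  strongLimit : κ.IsStrongLimit
  card_lt : Cardinal.lift.{w} (max ℵ₀ L.card) < Cardinal.lift.{max u v} κ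
  saturated : IsSaturated L M κ
  homogeneous : IsStronglyHomogeneous L M κ

end Monster

section Hyperdefinable

variable (L : FirstOrder.Language.{u, v}) {M : Type w} [L.Structure M] (κ : Cardinal.{w})

/-- `X ⊆ M` is `⋀`-definable (type-definable) over `A`. -/
def TypeDefinable (A X : Set M) : Prop :=
  ∃ S : Set (Set M), (∀ s ∈ S, A.Definable₁ L s) ∧ X = ⋂₀ S

/-- `X ⊆ M` is invariant under the automorphisms fixing `A` pointwise. -/
def InvariantOver (A X : Set M) : Prop :=
  ∀ σ : M ≃[L] M, (∀ c ∈ A, σ c = c) → σ '' X = X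

/-- `tp(x, y / A) = tp(x', y' / A)` for tuples `x`, `x'` of elements of `M / E` and tuples `y`,
`y'` of elements of `M`, where types over `A` are orbits under the automorphisms fixing `A`
pointwise: some such automorphism maps the class `x i` onto the class `x' i` for each `i`, and
`y j` to `y' j` for each `j`. -/
def SameType (A : Set M) (E : Setoid M) {ι γ : Type*} (x : ι → Quotient E) (y : γ → M)
    (x' : ι → Quotient E) (y' : γ → M) : Prop :=
  ∃ σ : M ≃[L] M, (∀ c ∈ A, σ c = c) ∧
    (∀ i, σ '' {m | Quotient.mk E m = x i} = {m | Quotient.mk E m = x' i}) ∧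
    ∀ j, σ (y j) = y' j

/-- The sequence `(a i, b i)`, `i < ω`, with `a i ∈ M / E` and `b i` a tuple from `M` indexed by
`β`, is `A`-indiscernible: any two increasing finite subsequences of the same length have the same
type over `A`. -/
def IsIndiscernible (A : Set M) (E : Setoid M) {β : Type w} (a : ℕ → Quotient E)
    (b : ℕ → β → M) : Prop :=
  ∀ (n : ℕ) (s t : Fin n → ℕ), StrictMono s → StrictMono t →
    SameType L A E (fun k => a (s k)) (fun p : Fin n × β => b (s p.1) p.2)
      (fun k => a (t k)) (fun p : Fin n × β => b (t p.1) p.2)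

/-- Stability of the hyperdefinable (over `A`) set `M / E`: for every `A`-indiscernible sequence
`(a i, b i)`, `i < ω`, with `a i ∈ M / E` and with `b i` tuples from `M` of any small length,
`tp(a i, b j / A) = tp(a j, b i / A)` for all `i ≠ j`. -/
def IsStableHyper (A : Set M) (E : Setoid M) : Prop :=
  ∀ (β : Type w), #β < κ → ∀ (a : ℕ → Quotient E) (b : ℕ → β → M),
    IsIndiscernible L A E a b → ∀ i j : ℕ, i ≠ j →
      SameType L A E (fun _ : Unit => a i) (b j) (fun _ : Unit => a j) (b i)

end Hyperdefinable

/-! ### Components of a group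

The group is the whole sort `M`, written additively. -/

section Components

variable (L : FirstOrder.Language.{u, v}) (M : Type w) [L.Structure M] [AddCommGroup M]
  (κ : Cardinal.{w})

/-- The subgroups `H` which are `⋀`-definable over a small set of parameters `A` and for which the
hyperdefinable (over `A`) set `M / H` is stable. -/
def stableQuotientSubgroups : Set (AddSubgroup M) :=
  {H | ∃ A : Set M, #A < κ ∧ TypeDefinable L A (H : Set M) ∧
    IsStableHyper L κ A (QuotientAddGroup.leftRel H)}

/-- The definable (with parameters) subgroups `H` for which `M / H` is stable. -/
def definableStableQuotientSubgroups : Set (AddSubgroup M) :=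
  {H | ∃ A : Set M, #A < κ ∧ A.Definable₁ L (H : Set M) ∧
    IsStableHyper L κ A (QuotientAddGroup.leftRel H)}

/-- The definable (with parameters) subgroups of bounded index. -/
def definableBoundedSubgroups : Set (AddSubgroup M) :=
  {H | (∃ A : Set M, #A < κ ∧ A.Definable₁ L (H : Set M)) ∧ #(M ⧸ H) < κ}

/-- The subgroups of bounded index which are `⋀`-definable over a small set of parameters. -/
def typeDefinableBoundedSubgroups : Set (AddSubgroup M) :=
  {H | (∃ A : Set M, #A < κ ∧ TypeDefinable L A (H : Set M)) ∧ #(M ⧸ H) < κ}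

/-- The subgroups of bounded index which are invariant over a small set of parameters. -/
def invariantBoundedSubgroups : Set (AddSubgroup M) :=
  {H | (∃ A : Set M, #A < κ ∧ InvariantOver L A (H : Set M)) ∧ #(M ⧸ H) < κ}

/-- `G^{st}`, the intersection of the `⋀`-definable subgroups with stable quotient. -/
def Gst : AddSubgroup M := sInf (stableQuotientSubgroups L M κ)

/-- `G^{st,0}`, the intersection of the definable subgroups with stable quotient. -/
def Gst0 : AddSubgroup M := sInf (definableStableQuotientSubgroups L M κ)

/-- `G^0`, the intersection of the definable subgroups of bounded index. -/
def G0 : AddSubgroup M := sInf (definableBoundedSubgroups L M κ)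

/-- `G^{00}`, the intersection of the `⋀`-definable subgroups of bounded index. -/
def G00 : AddSubgroup M := sInf (typeDefinableBoundedSubgroups L M κ)

/-- `G^{000}`, the intersection of the invariant subgroups of bounded index. -/
def G000 : AddSubgroup M := sInf (invariantBoundedSubgroups L M κ)

end Components

/-! ### The structure `(ℝ, +, [0,1])` -/

/-- The only function symbol: a binary symbol for addition. -/
inductive AddIFunc : ℕ → Type
  | add : AddIFunc 2

/-- The only relation symbol: a unary predicate for the unit interval. -/
inductive AddIRel : ℕ → Type
  | unit : AddIRel 1

/-- The language with a binary function symbol and a unary predicate. -/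
def langAddI : FirstOrder.Language.{0, 0} := ⟨AddIFunc, AddIRel⟩

/-- The symbol `+`. -/
def addSymb : langAddI.Functions 2 := AddIFunc.add

/-- The symbol `I`. -/
def unitSymb : langAddI.Relations 1 := AddIRel.unit

/-- The structure `(ℝ, +, [0,1])`. -/
instance realStructure : langAddI.Structure ℝ where
  funMap {_} f := match f with
    | AddIFunc.add => fun x => x 0 + x 1
  RelMap {_} r := match r with
    | AddIRel.unit => fun x => x 0 ∈ Set.Icc (0 : ℝ) 1

/-- `T = Th(ℝ, +, [0,1])`. -/
def realTheory : langAddI.Theory := langAddI.completeTheory ℝ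

section Infinitesimals

variable (M : Type w) [langAddI.Structure M] [AddCommGroup M]

/-- `[-1/n, 1/n]^*` for `n ≥ 1`, the interpretation in `M` of the formula `I(n x) ∨ I(-(n x))`,
which defines `[-1/n, 1/n]` in `(ℝ, +, [0,1])`. -/
def starInterval (n : ℕ) : Set M :=
  {x | Structure.RelMap unitSymb ![n • x] ∨ Structure.RelMap unitSymb ![-(n • x)]}

/-- The infinitesimals `⋂ n ≥ 1, [-1/n, 1/n]^*`. -/
def infinitesimals : Set M := ⋂ (n : ℕ) (_ : 1 ≤ n), starInterval M n

end Infinitesimals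

/-- Over `ℝ` itself, `starInterval` is the interval `[-1/n, 1/n]`. -/
theorem starInterval_real (n : ℕ) (hn : 1 ≤ n) :
    starInterval ℝ n = Set.Icc (-(1 / (n : ℝ))) (1 / (n : ℝ)) := by
  have hn' : (0 : ℝ) < n := by exact_mod_cast hn
  have key : ∀ y : ℝ, Structure.RelMap unitSymb ![y] ↔ 0 ≤ y ∧ y ≤ 1 := fun y => Iff.rfl
  ext x
  change (Structure.RelMap unitSymb ![n • x] ∨ Structure.RelMap unitSymb ![-(n • x)]) ↔
    -(1 / (n : ℝ)) ≤ x ∧ x ≤ 1 / (n : ℝ)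
  rw [key, key, nsmul_eq_mul, le_div_iff₀ hn', neg_le (a := 1 / (n : ℝ)), le_div_iff₀ hn']
  constructor
  · rintro (⟨h1, h2⟩ | ⟨h1, h2⟩) <;> constructor <;> linarith
  · rintro ⟨h1, h2⟩
    rcases le_total 0 ((n : ℝ) * x) with h | h
    · exact Or.inl ⟨h, by linarith⟩
    · exact Or.inr ⟨by linarith, by linarith⟩

end StableQuot

open StableQuot

/-! Put `x ≤ y` when `y - x` is a positive integer multiple of an element of `I`. This turns a model
into a partially ordered `ℚ`-vector space in which `I` is `[0, e]` and elements are comparable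
exactly when their difference is bounded by a multiple of `e`. So the model is a disjoint union of
chains, the cosets of its bounded part. By saturation, a back-and-forth over small subspaces
(`IsPartialIso.exists_sameCut`, `IsPartialIso.realize_iff`) shows that the type of `y` over a small
subspace `W` containing `e` is given by the cut of `y` in `W`. In particular, all elements
incomparable with the whole of `W` (generic elements) have one type over `W`.

Large subgroups: if an invariant subgroup contains some `h` generic over `W`, then `h + x` has the
same type over `W` for each `x ∈ W`, so `x` lies in the subgroup. Bounded index supplies such an `h`
as a difference of a generic element and a coset representative. A definable subgroup containing `μ`
contains some `ε • e` by compactness, hence all its multiples, and again a generic element.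

Stability of the quotient by `μ`: automorphisms fix every `q • e`, so they move bounded elements
only by infinitesimals. Modulo `μ`, an element comparable with a combination of the parameters is
therefore rigid relative to it, and the elements comparable with no combination have one type;
neither case orders an indiscernible sequence.

Minimality of `μ`: if `H` does not contain `μ`, then `H ∩ μ` is bounded inside `μ`, and
infinitesimals that grow fast enough form an indiscernible sequence whose order is still visible
modulo `H` (`IsOrderedModel.infSubgroup_le_of_isStableHyper`).

NIP follows from Fourier–Motzkin elimination in `ℝ` together with a count of the traces cut out by
finitely many affine functionals; instability is witnessed by `I(x + y)`. -/

namespace StableQuot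

/-! ### Transfer of first-order properties from `(ℝ, +, [0,1])` -/

section Terms

variable {α : Type*} {k : ℕ}

/-- The term `s + t`. -/
def addTerm (s t : langAddI.Term α) : langAddI.Term α := addSymb.apply₂ s t

/-- The term `(n + 1) t`, i.e. `t + ⋯ + t` with `n + 1` summands. -/
def nsmulTerm : ℕ → langAddI.Term α → langAddI.Term α
  | 0, t => t
  | n + 1, t => addTerm (nsmulTerm n t) t

/-- The formula `I(t)`. -/
def unitFormula (t : langAddI.Term (α ⊕ Fin k)) : langAddI.BoundedFormula α k :=
  unitSymb.boundedFormula₁ t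

variable {N : Type*} [langAddI.Structure N]

theorem realize_unitFormula (t : langAddI.Term (α ⊕ Fin k)) (v : α → N) (xs : Fin k → N) :
    (unitFormula t).Realize v xs ↔
      Structure.RelMap unitSymb ![t.realize (Sum.elim v xs)] :=
  BoundedFormula.realize_rel₁

variable [AddCommGroup N]

theorem realize_addTerm (hadd : ∀ x y : N, Structure.funMap addSymb ![x, y] = x + y)
    (s t : langAddI.Term α) (v : α → N) :
    (addTerm s t).realize v = s.realize v + t.realize v := by
  rw [addTerm, Term.realize_functions_apply₂, hadd]

theorem realize_nsmulTerm (hadd : ∀ x y : N, Structure.funMap addSymb ![x, y] = x + y)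
    (n : ℕ) (t : langAddI.Term α) (v : α → N) :
    (nsmulTerm n t).realize v = (n + 1) • t.realize v := by
  induction n with
  | zero => simp [nsmulTerm]
  | succ n ih => rw [nsmulTerm, realize_addTerm hadd, ih, ← succ_nsmul]

end Terms

/-- First-order properties of `(ℝ, +, [0,1])` which suffice to recover the order on the bounded
part of a model. -/
structure IsUnitIntervalGroup (N : Type*) [langAddI.Structure N] [AddCommGroup N] : Prop where
  divisible : ∀ (n : ℕ) (x : N), ∃ y : N, (n + 1) • y = x
  torsionFree : ∀ (n : ℕ) (x y : N), (n + 1) • x = (n + 1) • y → x = y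
  add_mem : ∀ (n m : ℕ) (x y : N), Structure.RelMap unitSymb ![x] →
    Structure.RelMap unitSymb ![y] →
    ∃ z : N, Structure.RelMap unitSymb ![z] ∧ (n + 1) • x + (m + 1) • y = (n + m + 1 + 1) • z
  -- The language has no symbol for `0`, so vanishing is expressed as being absorbed by `w`.
  eq_zero : ∀ (n m : ℕ) (x y w : N), Structure.RelMap unitSymb ![x] →
    Structure.RelMap unitSymb ![y] → (n + 1) • x + (m + 1) • y + w = w → x + w = w
  comparable : ∀ (n m : ℕ) (x y : N), Structure.RelMap unitSymb ![x] →
    Structure.RelMap unitSymb ![y] →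
    (∃ z : N, Structure.RelMap unitSymb ![z] ∧ (n + 1) • x = (m + 1) • y + (n + 1) • z) ∨
    (∃ z : N, Structure.RelMap unitSymb ![z] ∧ (n + 1) • x + (m + 1) • z = (m + 1) • y)
  convex : ∀ (n m : ℕ) (x y : N), Structure.RelMap unitSymb ![x] →
    Structure.RelMap unitSymb ![y] → Structure.RelMap unitSymb ![(n + 1) • x + (m + 1) • y] →
    Structure.RelMap unitSymb ![(n + 1) • x]
  mem_of_nsmul_mem : ∀ (n : ℕ) (x : N), Structure.RelMap unitSymb ![(n + 1) • x] →
    Structure.RelMap unitSymb ![x]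
  exists_unit : ∃ e : N, ¬ e + e = e ∧ Structure.RelMap unitSymb ![e] ∧
    ∀ x : N, Structure.RelMap unitSymb ![x] →
      ∃ z : N, Structure.RelMap unitSymb ![z] ∧ x + z = e

theorem unit_real_iff (x : ℝ) :
    Structure.RelMap (L := langAddI) unitSymb ![x] ↔ 0 ≤ x ∧ x ≤ 1 := Iff.rfl

theorem isUnitIntervalGroup_real : IsUnitIntervalGroup ℝ where
  divisible n x := ⟨x / (n + 1), by simp only [nsmul_eq_mul]; push_cast; field_simp⟩
  torsionFree n x y h := by
    have : (0 : ℝ) < n + 1 := by positivity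
    simp only [nsmul_eq_mul] at h
    push_cast at h
    exact mul_left_cancel₀ this.ne' h
  add_mem n m x y := by
    simp only [unit_real_iff, nsmul_eq_mul]
    push_cast
    rintro ⟨h1, h2⟩ ⟨h3, h4⟩
    refine ⟨((n + 1) * x + (m + 1) * y) / (n + m + 1 + 1), ⟨by positivity, ?_⟩, by field_simp⟩
    rw [div_le_one (by positivity)]
    have hn : (0 : ℝ) ≤ n + 1 := by positivity
    have hm : (0 : ℝ) ≤ m + 1 := by positivity
    linarith [mul_le_of_le_one_right hn h2, mul_le_of_le_one_right hm h4]
  eq_zero n m x y w := by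
    simp only [unit_real_iff, nsmul_eq_mul]
    push_cast
    rintro ⟨h1, -⟩ ⟨h3, -⟩ h
    have hn : (0 : ℝ) < n + 1 := by positivity
    have hm : (0 : ℝ) ≤ m + 1 := by positivity
    have hx : (n + 1) * x = 0 := by linarith [mul_nonneg hn.le h1, mul_nonneg hm h3]
    rcases mul_eq_zero.1 hx with h' | h'
    · exact absurd h' hn.ne'
    · rw [h', zero_add]
  comparable n m x y := by
    simp only [unit_real_iff, nsmul_eq_mul]
    push_cast
    rintro ⟨h1, h2⟩ ⟨h3, h4⟩
    have hn : (0 : ℝ) < n + 1 := by positivity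
    have hm : (0 : ℝ) < m + 1 := by positivity
    have hx := mul_nonneg hn.le h1
    have hy := mul_nonneg hm.le h3
    have hx' := mul_le_of_le_one_right hn.le h2
    have hy' := mul_le_of_le_one_right hm.le h4
    rcases le_total ((m + 1) * y) ((n + 1) * x) with h | h
    · refine Or.inl ⟨((n + 1) * x - (m + 1) * y) / (n + 1), ⟨?_, ?_⟩, by field_simp; ring⟩
      · exact div_nonneg (by linarith) hn.le
      · rw [div_le_one hn]; linarith
    · refine Or.inr ⟨((m + 1) * y - (n + 1) * x) / (m + 1), ⟨?_, ?_⟩, by field_simp; ring⟩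
      · exact div_nonneg (by linarith) hm.le
      · rw [div_le_one hm]; linarith
  convex n m x y := by
    simp only [unit_real_iff, nsmul_eq_mul]
    push_cast
    rintro ⟨h1, -⟩ ⟨h3, -⟩ ⟨-, h5⟩
    have hm : (0 : ℝ) ≤ m + 1 := by positivity
    exact ⟨by positivity, by linarith [mul_nonneg hm h3]⟩
  mem_of_nsmul_mem n x := by
    simp only [unit_real_iff, nsmul_eq_mul]
    push_cast
    rintro ⟨h1, h2⟩
    have hn : (0 : ℝ) < n + 1 := by positivity
    have h0 : 0 ≤ x := nonneg_of_mul_nonneg_right h1 hn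
    exact ⟨h0, by nlinarith [mul_nonneg (Nat.cast_nonneg (α := ℝ) n) h0]⟩
  exists_unit := by
    simp only [unit_real_iff]
    exact ⟨1, by norm_num, by norm_num, fun x hx => ⟨1 - x, ⟨by linarith, by linarith⟩, by ring⟩⟩

/-- Completeness of `Th(ℝ, +, [0,1])`, arranged so that the formula is only a bridge between two
plainly stated properties. -/
theorem realize_of_realTheory {N : Type*} [langAddI.Structure N] (hT : N ⊨ realTheory)
    {P Q : Prop} (φ : langAddI.Sentence) (hP : ℝ ⊨ φ ↔ P) (hQ : N ⊨ φ ↔ Q) (h : P) : Q := by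
  have : N ⊨ langAddI.completeTheory ℝ := hT
  exact hQ.1 ((realize_iff_of_model_completeTheory ℝ N φ).2 (hP.2 h))

section TransferAxioms

variable {N : Type*} [langAddI.Structure N] [AddCommGroup N]

theorem isUnitIntervalGroup_of_realTheory
    (hadd : ∀ x y : N, Structure.funMap addSymb ![x, y] = x + y) (hT : N ⊨ realTheory) :
    IsUnitIntervalGroup N := by
  have hR : ∀ x y : ℝ, Structure.funMap addSymb ![x, y] = x + y := fun x y => rfl
  refine ⟨fun n => ?_, fun n => ?_, fun n m => ?_, fun n m => ?_, fun n m => ?_, fun n m => ?_,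
    fun n => ?_, ?_⟩
  · refine realize_of_realTheory hT (∀' ∃' (nsmulTerm n (&1) =' &0)) ?_ ?_
      (isUnitIntervalGroup_real.divisible n) <;>
    simp [Sentence.Realize, Formula.Realize, realize_nsmulTerm, hadd, hR, Fin.snoc]
  · refine realize_of_realTheory hT
      (∀' ∀' ((nsmulTerm n (&0) =' nsmulTerm n (&1)) ⟹ (&0 =' &1))) ?_ ?_
      (isUnitIntervalGroup_real.torsionFree n) <;>
    simp only [Sentence.Realize, Formula.Realize] <;>
    simp [Fin.snoc, realize_nsmulTerm, hadd, hR]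
  · refine realize_of_realTheory hT
      (∀' ∀' (unitFormula (&0) ⟹ unitFormula (&1) ⟹ ∃' (unitFormula (&2) ⊓
        (addTerm (nsmulTerm n (&0)) (nsmulTerm m (&1)) =' nsmulTerm (n + m + 1) (&2))))) ?_ ?_
      (isUnitIntervalGroup_real.add_mem n m) <;>
    simp [Sentence.Realize, Formula.Realize, realize_nsmulTerm, realize_addTerm,
      realize_unitFormula, hadd, hR, Fin.snoc]
  · refine realize_of_realTheory hT
      (∀' ∀' ∀' (unitFormula (&0) ⟹ unitFormula (&1) ⟹
        (addTerm (addTerm (nsmulTerm n (&0)) (nsmulTerm m (&1))) (&2) =' (&2)) ⟹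
        (addTerm (&0) (&2) =' (&2)))) ?_ ?_
      (isUnitIntervalGroup_real.eq_zero n m) <;>
    simp [Sentence.Realize, Formula.Realize, realize_nsmulTerm, realize_addTerm,
      realize_unitFormula, hadd, hR, Fin.snoc]
  · refine realize_of_realTheory hT
      (∀' ∀' (unitFormula (&0) ⟹ unitFormula (&1) ⟹ (∃' (unitFormula (&2) ⊓
        (nsmulTerm n (&0) =' addTerm (nsmulTerm m (&1)) (nsmulTerm n (&2))))) ⊔
        (∃' (unitFormula (&2) ⊓
        (addTerm (nsmulTerm n (&0)) (nsmulTerm m (&2)) =' nsmulTerm m (&1)))))) ?_ ?_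
      (isUnitIntervalGroup_real.comparable n m) <;>
    simp [Sentence.Realize, Formula.Realize, realize_nsmulTerm, realize_addTerm,
      realize_unitFormula, hadd, hR, Fin.snoc]
  · refine realize_of_realTheory hT
      (∀' ∀' (unitFormula (&0) ⟹ unitFormula (&1) ⟹
        unitFormula (addTerm (nsmulTerm n (&0)) (nsmulTerm m (&1))) ⟹
        unitFormula (nsmulTerm n (&0)))) ?_ ?_
      (isUnitIntervalGroup_real.convex n m) <;>
    simp [Sentence.Realize, Formula.Realize, realize_nsmulTerm, realize_addTerm,
      realize_unitFormula, hadd, hR, Fin.snoc]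
  · refine realize_of_realTheory hT
      (∀' (unitFormula (nsmulTerm n (&0)) ⟹ unitFormula (&0))) ?_ ?_
      (isUnitIntervalGroup_real.mem_of_nsmul_mem n) <;>
    simp [Sentence.Realize, Formula.Realize, realize_nsmulTerm,
      realize_unitFormula, hadd, hR, Fin.snoc]
  · refine realize_of_realTheory hT
      (∃' (∼(addTerm (&0) (&0) =' &0) ⊓ (unitFormula (&0) ⊓
        ∀' (unitFormula (&1) ⟹ ∃' (unitFormula (&2) ⊓ (addTerm (&1) (&2) =' &0)))))) ?_ ?_
      isUnitIntervalGroup_real.exists_unit <;>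
    simp [Sentence.Realize, Formula.Realize, realize_addTerm,
      realize_unitFormula, hadd, hR, Fin.snoc]

end TransferAxioms

/-! ### Models of the theory as partially ordered `ℚ`-vector spaces -/

section RatModule

variable {M : Type*} [AddCommGroup M]

/-- A divisible torsion-free abelian group is a `ℚ`-vector space. -/
noncomputable abbrev ratModule (hdiv : ∀ (n : ℕ) (x : M), ∃ y : M, (n + 1) • y = x)
    (htf : ∀ (n : ℕ) (x y : M), (n + 1) • x = (n + 1) • y → x = y) : Module ℚ M := by
  have hdiv' : ∀ (q : ℚ) (x : M), ∃ y : M, q.den • y = q.num • x := fun q x => by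
    obtain ⟨n, hn⟩ := Nat.exists_eq_succ_of_ne_zero q.den_nz
    rw [hn]
    exact hdiv n _
  have htf' : ∀ n : ℕ, n ≠ 0 → ∀ x y : M, n • x = n • y → x = y := fun n hn x y h => by
    obtain ⟨n, rfl⟩ := Nat.exists_eq_succ_of_ne_zero hn
    exact htf n x y h
  choose f hf using hdiv'
  -- `f q x` is defined through the reduced fraction of `q`, but it solves the equation for any
  -- fraction `m / n` equal to `q`. The module axioms then reduce to choosing common denominators.
  have key : ∀ (q : ℚ) (x : M) (n : ℕ) (m : ℤ), q * n = m → n • f q x = m • x := by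
    intro q x n m h
    apply htf' q.den q.den_nz
    have h1 : q.num * n = m * q.den := by
      have : (q.num : ℚ) * n = m * q.den := by
        linear_combination q.den * h - n * q.mul_den_eq_num
      exact_mod_cast this
    rw [← natCast_zsmul, ← natCast_zsmul, ← natCast_zsmul, smul_smul, mul_comm, mul_smul,
      natCast_zsmul (f q x), hf, smul_smul, smul_smul, mul_comm, h1, mul_comm]
  have uniq : ∀ (q : ℚ) (x y : M) (n : ℕ) (m : ℤ), n ≠ 0 → q * n = m → n • y = m • x →
      f q x = y := fun q x y n m hn h hy => htf' n hn _ _ ((key q x n m h).trans hy.symm)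
  exact
  { smul := f
    one_smul := fun x => uniq 1 x x 1 1 one_ne_zero (by norm_num) (by simp)
    mul_smul := fun p q x => by
      refine uniq (p * q) x (f p (f q x)) (q.den * p.den) (p.num * q.num)
        (mul_ne_zero q.den_nz p.den_nz) ?_ ?_
      · push_cast
        linear_combination q * q.den * p.mul_den_eq_num + p.num * q.mul_den_eq_num
      · rw [mul_smul, hf, smul_comm, hf, smul_smul]
    smul_zero := fun q => uniq q 0 0 q.den q.num q.den_nz q.mul_den_eq_num (by simp)
    smul_add := fun q x y => by
      refine uniq q (x + y) (f q x + f q y) q.den q.num q.den_nz q.mul_den_eq_num ?_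
      rw [smul_add, smul_add, hf, hf]
    add_smul := fun p q x => by
      refine uniq (p + q) x (f p x + f q x) (p.den * q.den) (p.num * q.den + q.num * p.den)
        (mul_ne_zero p.den_nz q.den_nz) ?_ ?_
      · push_cast
        linear_combination (q.den : ℚ) * p.mul_den_eq_num + (p.den : ℚ) * q.mul_den_eq_num
      · rw [smul_add, add_smul, key p x (p.den * q.den) (p.num * q.den),
          key q x (p.den * q.den) (q.num * p.den)]
        · push_cast; linear_combination (p.den : ℚ) * q.mul_den_eq_num
        · push_cast; linear_combination (q.den : ℚ) * p.mul_den_eq_num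
    zero_smul := fun x => uniq 0 x 0 1 0 one_ne_zero (by norm_num) (by simp) }

end RatModule

section Order

variable {M : Type*} [langAddI.Structure M] [AddCommGroup M]

theorem IsUnitIntervalGroup.unit_zero (h : IsUnitIntervalGroup M) :
    Structure.RelMap unitSymb ![(0 : M)] := by
  obtain ⟨e, -, he, h'⟩ := h.exists_unit
  obtain ⟨z, hz, hze⟩ := h' e he
  rwa [show z = 0 by simpa using hze] at hz

/-- The partial order on a model in which `x ≤ y` if `y - x` is a multiple of an element of the
unit interval. -/
abbrev IsUnitIntervalGroup.partialOrder (h : IsUnitIntervalGroup M) : PartialOrder M where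
  le x y := ∃ (n : ℕ) (z : M), Structure.RelMap unitSymb ![z] ∧ y - x = (n + 1) • z
  le_refl x := ⟨0, 0, h.unit_zero, by simp⟩
  le_trans x y z := by
    rintro ⟨n, a, ha, hxy⟩ ⟨m, b, hb, hyz⟩
    obtain ⟨c, hc, hc'⟩ := h.add_mem n m a b ha hb
    exact ⟨n + m + 1, c, hc, by rw [← hc', ← hxy, ← hyz]; abel⟩
  le_antisymm x y := by
    rintro ⟨n, a, ha, hxy⟩ ⟨m, b, hb, hyx⟩
    have := h.eq_zero n m a b 0 ha hb (by rw [← hxy, ← hyx]; abel)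
    simp only [add_zero] at this
    rw [this, smul_zero] at hxy
    exact (sub_eq_zero.1 hxy).symm

end Order

/-- A model of `Th(ℝ, +, [0,1])`, seen as a partially ordered group in which `I` is the interval
`[0, e]` and two elements are comparable iff their difference is bounded by a multiple of `e`. -/
structure IsOrderedModel {M : Type*} [langAddI.Structure M] [AddCommGroup M] [Module ℚ M]
    [PartialOrder M] (e : M) : Prop where
  funMap_add : ∀ x y : M, Structure.funMap addSymb ![x, y] = x + y
  unit_iff : ∀ x : M, Structure.RelMap unitSymb ![x] ↔ 0 ≤ x ∧ x ≤ e
  pos : 0 < e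
  total : ∀ x y : M, 0 ≤ x → 0 ≤ y → x ≤ y ∨ y ≤ x
  arch : ∀ x : M, 0 ≤ x → ∃ n : ℕ, x ≤ (n : ℚ) • e

section

variable {M : Type*} [langAddI.Structure M] [AddCommGroup M]

/-- The positive cone consists of the positive multiples of elements of `I`. Divisibility and
`mem_of_nsmul_mem` make it stable under positive rationals, `comparable` makes it a chain, and
`convex` recovers `I` as `[0, e]`. -/
theorem exists_isOrderedModel (hadd : ∀ x y : M, Structure.funMap addSymb ![x, y] = x + y)
    (h : IsUnitIntervalGroup M) :
    ∃ (_ : Module ℚ M) (_ : PartialOrder M) (_ : IsOrderedAddMonoid M)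
      (_ : PosSMulStrictMono ℚ M) (e : M), IsOrderedModel e := by
  let _ := ratModule h.divisible h.torsionFree
  let _ := h.partialOrder
  have hle : ∀ x y : M, x ≤ y ↔
    ∃ (n : ℕ) (z : M), Structure.RelMap unitSymb ![z] ∧ y - x = (n + 1) • z := fun x y => Iff.rfl
  have h0 : ∀ x : M, 0 ≤ x ↔
    ∃ (n : ℕ) (z : M), Structure.RelMap unitSymb ![z] ∧ x = (n + 1) • z := fun x => by
      rw [hle, sub_zero]
  have ord : IsOrderedAddMonoid M := ⟨fun x y hxy z => by
    rw [hle] at hxy ⊢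
    simpa using hxy, fun x y hxy z => by
    rw [hle] at hxy ⊢
    simpa using hxy⟩
  have hq : ∀ (q : ℚ) (x : M), 0 < q → 0 ≤ x → 0 ≤ q • x := by
    intro q x hqp hx
    obtain ⟨n, z, hz, rfl⟩ := (h0 x).1 hx
    obtain ⟨d, hd⟩ := Nat.exists_eq_succ_of_ne_zero q.den_nz
    have hd' : (q.den : ℚ) = d + 1 := by exact_mod_cast hd
    obtain ⟨w, hw⟩ := h.divisible d z
    obtain ⟨k, hk⟩ : ∃ k : ℕ, q.num = k + 1 := by
      have := Rat.num_pos.2 hqp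
      exact ⟨(q.num - 1).toNat, by omega⟩
    have hwI : Structure.RelMap unitSymb ![w] := h.mem_of_nsmul_mem d w (by rwa [hw])
    have hk' : q = (k + 1) / (d + 1) := by
      rw [← hd', eq_div_iff (by exact_mod_cast q.den_nz), q.mul_den_eq_num, hk]
      push_cast
      rfl
    -- With `z = (d + 1) • w`, the element is `(k + 1) * (n + 1)` times `w`; the cone counts
    -- multiples from one, hence the `- 1`.
    refine (h0 _).2 ⟨(k + 1) * (n + 1) - 1, w, hwI, ?_⟩
    rw [← hw, Nat.sub_add_cancel (Nat.mul_pos k.succ_pos n.succ_pos),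
      ← Nat.cast_smul_eq_nsmul ℚ, ← Nat.cast_smul_eq_nsmul ℚ, ← Nat.cast_smul_eq_nsmul ℚ,
      smul_smul, smul_smul, hk']
    congr 1
    push_cast
    field_simp
  have psm : PosSMulStrictMono ℚ M := by
    have : PosSMulMono ℚ M := PosSMulMono.of_smul_nonneg fun q hq0 x hx => by
      rcases hq0.eq_or_lt with rfl | hq0
      · rw [zero_smul]
      · exact hq q x hq0 hx
    exact PosSMulMono.toPosSMulStrictMono
  obtain ⟨e, he, heI, he'⟩ := h.exists_unit
  refine ⟨inferInstance, inferInstance, ord, psm, e, hadd, fun x => ⟨fun hx => ⟨?_, ?_⟩, ?_⟩, ?_,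
    ?_, ?_⟩
  · exact (h0 x).2 ⟨0, x, hx, by simp⟩
  · obtain ⟨z, hz, rfl⟩ := he' x hx
    exact (hle _ _).2 ⟨0, z, hz, by simp⟩
  · rintro ⟨h1, h2⟩
    obtain ⟨n, z, hz, rfl⟩ := (h0 x).1 h1
    obtain ⟨m, y, hy, hxy⟩ := (hle _ _).1 h2
    refine h.convex n m z y hz hy ?_
    rw [← hxy]
    simpa using heI
  · refine lt_of_le_of_ne ((h0 e).2 ⟨0, e, heI, by simp⟩) fun h' => he ?_
    rw [← h', add_zero]
  · intro x y hx hy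
    obtain ⟨n, a, ha, rfl⟩ := (h0 x).1 hx
    obtain ⟨m, b, hb, rfl⟩ := (h0 y).1 hy
    rcases h.comparable n m a b ha hb with ⟨z, hz, hz'⟩ | ⟨z, hz, hz'⟩
    · exact Or.inr ((hle _ _).2 ⟨n, z, hz, by rw [hz']; abel⟩)
    · exact Or.inl ((hle _ _).2 ⟨m, z, hz, by rw [← hz']; abel⟩)
  · intro x hx
    obtain ⟨n, a, ha, rfl⟩ := (h0 x).1 hx
    obtain ⟨z, hz, rfl⟩ := he' a ha
    refine ⟨n + 1, ?_⟩
    rw [Nat.cast_smul_eq_nsmul, smul_add]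
    exact (hle _ _).2 ⟨n, z, hz, by abel⟩

end

/-! ### Cardinality of spans of small sets -/

section Small

theorem mem_sup_span_singleton_iff {V : Type*} [AddCommGroup V] [Module ℚ V]
    {W : Submodule ℚ V} {p x : V} :
    x ∈ W ⊔ Submodule.span ℚ {p} ↔ ∃ y ∈ W, ∃ q : ℚ, x = y + q • p := by
  simp only [Submodule.mem_sup, Submodule.mem_span_singleton]
  constructor
  · rintro ⟨y, hy, -, ⟨q, rfl⟩, rfl⟩
    exact ⟨y, hy, q, rfl⟩
  · rintro ⟨y, hy, q, rfl⟩
    exact ⟨y, hy, _, ⟨q, rfl⟩, rfl⟩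

variable {V : Type w} [AddCommGroup V] [Module ℚ V] {κ : Cardinal.{w}}

theorem mk_span_lt (hκ : ℵ₀ < κ) {s : Set V} (hs : #s < κ) :
    #(Submodule.span ℚ s) < κ := by
  -- Adding `0` leaves the span unchanged and makes the index set nonempty, as the cardinality
  -- formula for finitely supported functions requires.
  have h0 : #(insert (0 : V) s : Set V) < κ :=
    (mk_insert_le).trans_lt (add_lt_of_lt hκ.le hs (one_lt_aleph0.trans hκ))
  have hsurj : Function.Surjective (fun f : (insert (0 : V) s : Set V) →₀ ℚ =>
      (⟨Finsupp.linearCombination ℚ (fun x : (insert (0 : V) s : Set V) => (x : V)) f, by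
        rw [← Submodule.span_insert_zero]
        exact (Finsupp.mem_span_iff_linearCombination ℚ _ _).2 ⟨f, rfl⟩⟩ :
        Submodule.span ℚ s)) := by
    rintro ⟨x, hx⟩
    rw [← Submodule.span_insert_zero] at hx
    obtain ⟨f, hf⟩ := (Finsupp.mem_span_iff_linearCombination ℚ _ _).1 hx
    exact ⟨f, Subtype.ext hf⟩
  have : Nonempty (insert (0 : V) s : Set V) := ⟨⟨0, Set.mem_insert _ _⟩⟩
  refine lt_of_le_of_lt (mk_le_of_surjective hsurj) ?_
  rw [mk_finsupp_lift_of_infinite', lift_uzero, Cardinal.mkRat, lift_aleph0]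
  exact max_lt h0 hκ

theorem mk_sup_span_singleton_lt (hκ : ℵ₀ < κ) {W : Submodule ℚ V} (hW : #W < κ) (p : V) :
    #(W ⊔ Submodule.span ℚ {p} : Submodule ℚ V) < κ := by
  have hsurj : Function.Surjective (fun f : W × ℚ =>
      (⟨f.1 + f.2 • p, mem_sup_span_singleton_iff.2 ⟨f.1, f.1.2, f.2, rfl⟩⟩ :
        (W ⊔ Submodule.span ℚ {p} : Submodule ℚ V))) := by
    rintro ⟨x, hx⟩
    obtain ⟨y, hy, q, rfl⟩ := mem_sup_span_singleton_iff.1 hx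
    exact ⟨(⟨y, hy⟩, q), rfl⟩
  refine lt_of_le_of_lt (mk_le_of_surjective hsurj) ?_
  rw [mk_prod, lift_uzero, Cardinal.mkRat, lift_aleph0]
  exact mul_lt_of_lt hκ.le hW hκ

end Small

/-! ### Comparability and definable intervals -/

section OrderedModel

variable {M : Type w} [langAddI.Structure M] [AddCommGroup M] [Module ℚ M] [PartialOrder M]
  {e : M}

namespace IsOrderedModel

/-- Translating by `c` reduces this to the positive cone, which is a chain. It replaces totality of
the order throughout. -/
theorem total_of_ge [IsOrderedAddMonoid M] (hO : IsOrderedModel e) {a b c : M} (ha : c ≤ a)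
    (hb : c ≤ b) : a ≤ b ∨ b ≤ a := by
  simpa using hO.total (a - c) (b - c) (sub_nonneg.2 ha) (sub_nonneg.2 hb)

theorem total_of_le [IsOrderedAddMonoid M] (hO : IsOrderedModel e) {a b c : M} (ha : a ≤ c)
    (hb : b ≤ c) : a ≤ b ∨ b ≤ a := by
  exact (hO.total (c - b) (c - a) (sub_nonneg.2 hb) (sub_nonneg.2 ha)).imp
    (sub_le_sub_iff_left c).1 (sub_le_sub_iff_left c).1

theorem exists_le_add [IsOrderedAddMonoid M] (hO : IsOrderedModel e) {a b : M} (h : a ≤ b) :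
    ∃ n : ℕ, b ≤ a + (n : ℚ) • e := by
  obtain ⟨n, hn⟩ := hO.arch (b - a) (sub_nonneg.2 h)
  exact ⟨n, sub_le_iff_le_add'.1 hn⟩

/-- The order is a union over `n` of definable relations, but inside one interval a single `n` with
`b ≤ a + n • e` is enough: membership says that `x` is `a` plus `n + 1` times an element of `I`, and
`b` is `x` plus such a multiple. -/
theorem definable_Icc [IsOrderedAddMonoid M] [PosSMulStrictMono ℚ M] (hO : IsOrderedModel e)
    {A : Set M} {a b : M} (ha : a ∈ A) (hb : b ∈ A) :
    A.Definable₁ langAddI (Set.Icc a b) := by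
  by_cases hab : a ≤ b
  swap
  · rw [Set.Icc_eq_empty hab]
    exact Set.definable_empty
  obtain ⟨n, hn⟩ := hO.exists_le_add hab
  have hn' : b ≤ a + ((n : ℚ) + 1) • e := by
    rw [add_smul, one_smul, ← add_assoc]
    exact hn.trans (le_add_of_nonneg_right hO.pos.le)
  have hpos : (0 : ℚ) < n + 1 := by positivity
  refine Set.definable_iff_exists_formula_sum.2 ⟨∃' ∃' (unitFormula (&0) ⊓ (unitFormula (&1) ⊓
    ((addTerm (var (Sum.inl (Sum.inl ⟨a, ha⟩))) (nsmulTerm n (&0)) =' var (Sum.inl (Sum.inr 0))) ⊓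
    (addTerm (var (Sum.inl (Sum.inr 0))) (nsmulTerm n (&1)) ='
      var (Sum.inl (Sum.inl ⟨b, hb⟩)))))), ?_⟩
  ext v
  have hs : ∀ z : M, (n + 1) • z = ((n : ℚ) + 1) • z := fun z => by
    rw [← Nat.cast_smul_eq_nsmul ℚ]; push_cast; rfl
  simp only [Set.mem_ofPred_eq, Formula.Realize, BoundedFormula.realize_ex,
    BoundedFormula.realize_inf, realize_unitFormula, BoundedFormula.realize_bdEqual,
    realize_addTerm hO.funMap_add, realize_nsmulTerm hO.funMap_add, Term.realize_var,
    Sum.elim_inl, Sum.elim_inr, hO.unit_iff, hs]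
  change v 0 ∈ Set.Icc a b ↔ ∃ u t : M, (0 ≤ u ∧ u ≤ e) ∧ (0 ≤ t ∧ t ≤ e) ∧
    a + ((n : ℚ) + 1) • u = v 0 ∧ v 0 + ((n : ℚ) + 1) • t = b
  have hmem : ∀ x y : M, x ≤ y → y ≤ x + ((n : ℚ) + 1) • e →
      ∃ u : M, (0 ≤ u ∧ u ≤ e) ∧ x + ((n : ℚ) + 1) • u = y := fun x y h1 h2 =>
    ⟨((n : ℚ) + 1)⁻¹ • (y - x), ⟨smul_nonneg (by positivity) (sub_nonneg.2 h1),
      (inv_smul_le_iff_of_pos hpos).2 (sub_le_iff_le_add'.2 h2)⟩, by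
      rw [smul_smul, mul_inv_cancel₀ hpos.ne', one_smul, add_sub_cancel]⟩
  constructor
  · rintro ⟨h1, h2⟩
    obtain ⟨u, hu, hu'⟩ := hmem a (v 0) h1 (h2.trans hn')
    obtain ⟨t, ht, ht'⟩ := hmem (v 0) b h2 (hn'.trans (by gcongr))
    exact ⟨u, t, hu, ht, hu', ht'⟩
  · rintro ⟨u, t, hu, ht, h1, h2⟩
    rw [← h2, ← h1]
    exact ⟨le_add_of_nonneg_right (smul_nonneg hpos.le hu.1),
      le_add_of_nonneg_right (smul_nonneg hpos.le ht.1)⟩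

theorem definable_Ioo [IsOrderedAddMonoid M] [PosSMulStrictMono ℚ M] (hO : IsOrderedModel e)
    {A : Set M} {a b : M} (ha : a ∈ A) (hb : b ∈ A) :
    A.Definable₁ langAddI (Set.Ioo a b) := by
  have h : Set.Ioo a b = Set.Icc a b \ (Set.Icc a a ∪ Set.Icc b b) := by
    ext x
    simp only [Set.Icc_self, Set.mem_Ioo, Set.mem_sdiff, Set.mem_Icc, Set.mem_union,
      Set.mem_singleton_iff, not_or, lt_iff_le_and_ne]
    tauto
  rw [h]
  exact (hO.definable_Icc ha hb).sdiff ((hO.definable_Icc ha ha).union (hO.definable_Icc hb hb))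

end IsOrderedModel

end OrderedModel

/-- In a saturated structure, a downward directed family of nonempty sets definable over a small
set has a common element. -/
theorem IsSaturated.nonempty_sInter {L : FirstOrder.Language.{u, v}} {M : Type w} [L.Structure M]
    {κ : Cardinal.{w}} (hs : IsSaturated L M κ) {A : Set M} (hA : #A < κ) {S : Set (Set M)}
    (hne : S.Nonempty) (hdef : ∀ s ∈ S, A.Definable₁ L s)
    (hdir : ∀ s ∈ S, ∀ t ∈ S, ∃ r ∈ S, r ⊆ s ∧ r ⊆ t) (hn : ∀ s ∈ S, s.Nonempty) :
    (⋂₀ S).Nonempty := by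
  classical
  refine hs A hA S hdef fun F hF => ?_
  have key : ∀ F : Finset (Set M), (F : Set (Set M)) ⊆ S → ∃ r ∈ S, ∀ s ∈ F, r ⊆ s := by
    intro F
    induction F using Finset.induction with
    | empty => exact fun _ => ⟨_, hne.some_mem, by simp⟩
    | insert s F _ ih =>
      intro hF
      rw [Finset.coe_insert, Set.insert_subset_iff] at hF
      obtain ⟨r, hr, h⟩ := ih hF.2
      obtain ⟨t, ht, hts, htr⟩ := hdir s hF.1 r hr
      refine ⟨t, ht, fun x hx => ?_⟩
      rcases Finset.mem_insert.1 hx with rfl | hx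
      · exact hts
      · exact htr.trans (h x hx)
  obtain ⟨r, hr, h⟩ := key F hF
  exact (hn r hr).mono (Set.subset_sInter fun s hs => h s hs)

/-! ### Partial isomorphisms and automorphisms -/

section PartialIso

variable {M : Type w} [AddCommGroup M] [Module ℚ M]

/-- The inverse of a partial isomorphism, as a subspace of `M × M`. -/
def swapGraph (Γ : Submodule ℚ (M × M)) : Submodule ℚ (M × M) :=
  Γ.comap (LinearEquiv.prodComm ℚ M M : M × M →ₗ[ℚ] M × M)

theorem mk_swapGraph {Γ : Submodule ℚ (M × M)} : #(swapGraph Γ) = #Γ :=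
  mk_congr ⟨fun p => ⟨p.1.swap, p.2⟩, fun p => ⟨p.1.swap, p.2⟩, fun _ => rfl, fun _ => rfl⟩

theorem mk_map_fst_lt {κ : Cardinal.{w}} {Γ : Submodule ℚ (M × M)} (hΓ : #Γ < κ) :
    #(Γ.map (LinearMap.fst ℚ M M)) < κ :=
  (mk_image_le (f := LinearMap.fst ℚ M M) (s := (Γ : Set (M × M)))).trans_lt hΓ

theorem mk_map_snd_lt {κ : Cardinal.{w}} {Γ : Submodule ℚ (M × M)} (hΓ : #Γ < κ) :
    #(Γ.map (LinearMap.snd ℚ M M)) < κ :=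
  (mk_image_le (f := LinearMap.snd ℚ M M) (s := (Γ : Set (M × M)))).trans_lt hΓ

variable [PartialOrder M]

/-- A subspace of `M × M` which is the graph of an isomorphism of partially ordered vector spaces
between two subspaces of `M` that contain `e`, fixing `e`. -/
structure IsPartialIso (e : M) (Γ : Submodule ℚ (M × M)) : Prop where
  unit_mem : (e, e) ∈ Γ
  nonneg_iff : ∀ p ∈ Γ, 0 ≤ p.1 ↔ 0 ≤ p.2

/-- `y` and `y'` fill corresponding cuts of the domain and of the range of `Γ`. -/
def SameCut (Γ : Submodule ℚ (M × M)) (y y' : M) : Prop :=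
  ∀ p ∈ Γ, (p.1 ≤ y ↔ p.2 ≤ y') ∧ (y ≤ p.1 ↔ y' ≤ p.2)

variable {e : M} {Γ : Submodule ℚ (M × M)}

theorem IsPartialIso.smul_unit_mem (h : IsPartialIso e Γ) (q : ℚ) : (q • e, q • e) ∈ Γ :=
  Γ.smul_mem q h.unit_mem

theorem IsPartialIso.swap (h : IsPartialIso e Γ) : IsPartialIso e (swapGraph Γ) :=
  ⟨h.unit_mem, fun p hp => (h.nonneg_iff p.swap hp).symm⟩

theorem SameCut.of_swapGraph {y y' : M} (h : SameCut (swapGraph Γ) y' y) : SameCut Γ y y' :=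
  fun p hp => ⟨(h p.swap hp).1.symm, (h p.swap hp).2.symm⟩

variable [IsOrderedAddMonoid M]

theorem IsPartialIso.le_iff (h : IsPartialIso e Γ) {p r : M × M} (hp : p ∈ Γ) (hr : r ∈ Γ) :
    p.1 ≤ r.1 ↔ p.2 ≤ r.2 := by
  rw [← sub_nonneg, ← sub_nonneg (a := r.2)]
  exact h.nonneg_iff (r - p) (Γ.sub_mem hr hp)

theorem IsPartialIso.lt_iff (h : IsPartialIso e Γ) {p r : M × M} (hp : p ∈ Γ) (hr : r ∈ Γ) :
    p.1 < r.1 ↔ p.2 < r.2 := by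
  rw [lt_iff_le_not_ge, lt_iff_le_not_ge, h.le_iff hp hr, h.le_iff hr hp]

theorem IsPartialIso.eq_iff (h : IsPartialIso e Γ) {p r : M × M} (hp : p ∈ Γ) (hr : r ∈ Γ) :
    p.1 = r.1 ↔ p.2 = r.2 := by
  rw [le_antisymm_iff, le_antisymm_iff, h.le_iff hp hr, h.le_iff hr hp]

variable [PosSMulStrictMono ℚ M]

/-- For `q ≠ 0`, the sign of `x + q • y` is decided by comparing `y` with `-q⁻¹ • x`, which again
lies in the domain; so the cut of `y` carries all the order information. -/
theorem IsPartialIso.extend (h : IsPartialIso e Γ) {y y' : M} (hy : SameCut Γ y y') :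
    IsPartialIso e (Γ ⊔ Submodule.span ℚ {(y, y')}) := by
  refine ⟨Submodule.mem_sup_left h.unit_mem, fun p hp => ?_⟩
  obtain ⟨r, hr, q, rfl⟩ := mem_sup_span_singleton_iff.1 hp
  simp only [Prod.fst_add, Prod.snd_add, Prod.smul_fst, Prod.smul_snd]
  have e1 : ∀ x z : M, q ≠ 0 → q⁻¹ • (x + q • z) = z - (-q⁻¹) • x := fun x z hq => by
    rw [smul_add, smul_smul, inv_mul_cancel₀ hq, one_smul, neg_smul, sub_neg_eq_add, add_comm]
  rcases lt_trichotomy q 0 with hq | rfl | hq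
  · have e2 : ∀ x z : M, 0 ≤ x + q • z ↔ z ≤ (-q⁻¹) • x := fun x z => by
      rw [← sub_nonpos (a := z), ← e1 x z hq.ne, ← neg_nonneg, ← neg_smul,
        smul_nonneg_iff_nonneg_of_pos_left (neg_pos.2 (inv_lt_zero.2 hq))]
    rw [e2, e2]
    exact (hy _ (Γ.smul_mem (-q⁻¹) hr)).2
  · simpa using h.nonneg_iff r hr
  · have e2 : ∀ x z : M, 0 ≤ x + q • z ↔ (-q⁻¹) • x ≤ z := fun x z => by
      rw [← sub_nonneg (a := z), ← e1 x z hq.ne',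
        smul_nonneg_iff_nonneg_of_pos_left (inv_pos.2 hq)]
    rw [e2, e2]
    exact (hy _ (Γ.smul_mem (-q⁻¹) hr)).1

end PartialIso

theorem IsOrderedModel.realize_term_mem {M : Type*} [langAddI.Structure M] [AddCommGroup M]
    [Module ℚ M] [PartialOrder M] {e : M} (hO : IsOrderedModel e) {Γ : Submodule ℚ (M × M)}
    {α : Type*} (t : langAddI.Term α) {v v' : α → M}
    (hv : ∀ i, (v i, v' i) ∈ Γ) : (t.realize v, t.realize v') ∈ Γ := by
  induction t with
  | var i => exact hv i
  | func f ts ih =>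
    cases f with
    | add =>
      have hf : ∀ x : Fin 2 → M, Structure.funMap (L := langAddI) AddIFunc.add x = x 0 + x 1 :=
        fun x => by
          rw [← hO.funMap_add]
          congr 1
          ext i
          fin_cases i <;> rfl
      change (Structure.funMap (L := langAddI) AddIFunc.add _,
        Structure.funMap (L := langAddI) AddIFunc.add _) ∈ Γ
      rw [hf, hf]
      exact Γ.add_mem (ih 0) (ih 1)

/-! ### Filling cuts by saturation, and back-and-forth -/

section Saturated

variable {M : Type w} [langAddI.Structure M] [AddCommGroup M] [Module ℚ M] [PartialOrder M]
  [IsOrderedAddMonoid M] [PosSMulStrictMono ℚ M] {e : M} {κ : Cardinal.{w}}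

/-- A set which is definable over a small subspace `W` and contains all multiples of some positive
`ε • e` has an element at unbounded distance from `W`. -/
theorem IsOrderedModel.exists_generic_mem (hO : IsOrderedModel e)
    (hs : IsSaturated langAddI M κ) {W : Submodule ℚ M} (hW : #W < κ) (he : e ∈ W) {D : Set M}
    (hD : (W : Set M).Definable₁ langAddI D) {ε : ℚ} (hε : 0 < ε)
    (hmem : ∀ m : ℕ, (m : ℚ) • ε • e ∈ D) :
    ∃ y ∈ D, ∀ w ∈ W, ¬ w ≤ y ∧ ¬ y ≤ w := by
  have hew : ∀ w ∈ W, ∀ n : ℕ, w - (n : ℚ) • e ∈ W ∧ w + (n : ℚ) • e ∈ W := fun w hw n =>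
    ⟨W.sub_mem hw (W.smul_mem _ he), W.add_mem hw (W.smul_mem _ he)⟩
  -- By `exists_le_add`, any comparability with `w` would place `y` in some interval `[w - n • e, w
  -- + n • e]`, so it suffices to avoid all these intervals.
  suffices h : (⋂₀ (insert D {s | ∃ w ∈ W, ∃ n : ℕ,
      s = (Set.Icc (w - (n : ℚ) • e) (w + (n : ℚ) • e))ᶜ})).Nonempty by
    obtain ⟨y, hy⟩ := h
    simp only [Set.sInter_insert, Set.mem_inter_iff, Set.mem_sInter] at hy
    have hy' : ∀ w ∈ W, ∀ n : ℕ, ¬ (w - (n : ℚ) • e ≤ y ∧ y ≤ w + (n : ℚ) • e) :=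
      fun w hw n => hy.2 _ ⟨w, hw, n, rfl⟩
    refine ⟨y, hy.1, fun w hw => ⟨fun h => ?_, fun h => ?_⟩⟩
    · obtain ⟨n, hn⟩ := hO.exists_le_add h
      exact hy' w hw n ⟨(sub_le_self _ (smul_nonneg n.cast_nonneg hO.pos.le)).trans h, hn⟩
    · obtain ⟨n, hn⟩ := hO.exists_le_add h
      exact hy' w hw n ⟨sub_le_iff_le_add.2 hn,
        h.trans (le_add_of_nonneg_right (smul_nonneg n.cast_nonneg hO.pos.le))⟩
  refine hs W hW _ ?_ ?_
  · rintro s (rfl | ⟨w, hw, n, rfl⟩)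
    · exact hD
    · exact (hO.definable_Icc (hew w hw n).1 (hew w hw n).2).compl
  · intro F hF
    have hev : ∀ s ∈ F, ∀ᶠ m : ℕ in Filter.atTop, (m : ℚ) • ε • e ∈ s := by
      intro s hs
      rcases hF hs with rfl | ⟨w, hw, n, rfl⟩
      · exact Filter.Eventually.of_forall hmem
      -- If the interval contains one multiple `m₀ • ε • e`, then, having length `2n • e`, it
      -- contains none with `m > m₀ + 2n / ε`. So finitely many intervals are all avoided by large
      -- `m`.
      · by_cases hex : ∃ m₀ : ℕ, (m₀ : ℚ) • ε • e ∈ Set.Icc (w - (n : ℚ) • e) (w + (n : ℚ) • e)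
        · obtain ⟨m₀, h1, -⟩ := hex
          obtain ⟨k, hk⟩ := exists_nat_gt (m₀ + 2 * n / ε)
          filter_upwards [Filter.eventually_ge_atTop k] with m hm h
          have h3 := h.2.trans (add_le_add_left (sub_le_iff_le_add.1 h1) _)
          rw [smul_smul, smul_smul, ← add_smul, ← add_smul,
            smul_le_smul_iff_of_pos_right hO.pos] at h3
          have hm' : (k : ℚ) ≤ m := by exact_mod_cast hm
          have h4 := mul_lt_mul_of_pos_right (hk.trans_le hm') hε
          rw [add_mul, div_mul_cancel₀ _ hε.ne'] at h4
          linarith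
        · push Not at hex
          exact Filter.Eventually.of_forall hex
    obtain ⟨m, hm⟩ := ((Filter.eventually_all_finset F).2 hev).exists
    exact ⟨_, fun s hs => hm s hs⟩

/-- An element at unbounded distance from every element of a small subspace. -/
theorem IsOrderedModel.exists_generic (hO : IsOrderedModel e)
    (hs : IsSaturated langAddI M κ) {W : Submodule ℚ M} (hW : #W < κ) (he : e ∈ W) :
    ∃ y, ∀ w ∈ W, ¬ w ≤ y ∧ ¬ y ≤ w := by
  obtain ⟨y, -, hy⟩ := hO.exists_generic_mem hs hW he (D := Set.univ) Set.definable_univ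
    one_pos fun _ => trivial
  exact ⟨y, hy⟩

/-- Elements of `X` have a common upper bound in `Y`, hence are comparable, and dually for `Y`. The
intervals `Ioo x y` are thus directed, and midpoints make them nonempty. -/
theorem IsOrderedModel.exists_between (hO : IsOrderedModel e)
    (hs : IsSaturated langAddI M κ) {W : Submodule ℚ M} (hW : #W < κ) {X Y : Set M}
    (hX : X ⊆ W) (hY : Y ⊆ W) (hX0 : X.Nonempty) (hY0 : Y.Nonempty)
    (hlt : ∀ x ∈ X, ∀ y ∈ Y, x < y) : ∃ z, (∀ x ∈ X, x < z) ∧ ∀ y ∈ Y, z < y := by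
  obtain ⟨x₀, hx₀⟩ := hX0
  obtain ⟨y₀, hy₀⟩ := hY0
  suffices h : (⋂₀ {s | ∃ x ∈ X, ∃ y ∈ Y, s = Set.Ioo x y}).Nonempty by
    obtain ⟨z, hz⟩ := h
    simp only [Set.mem_sInter] at hz
    exact ⟨z, fun x hx => (hz _ ⟨x, hx, y₀, hy₀, rfl⟩).1,
      fun y hy => (hz _ ⟨x₀, hx₀, y, hy, rfl⟩).2⟩
  refine hs.nonempty_sInter hW ⟨_, x₀, hx₀, y₀, hy₀, rfl⟩ ?_ ?_ ?_
  · rintro s ⟨x, hx, y, hy, rfl⟩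
    exact hO.definable_Ioo (hX hx) (hY hy)
  · rintro s ⟨x, hx, y, hy, rfl⟩ t ⟨x', hx', y', hy', rfl⟩
    have h1 : ∃ a ∈ X, x ≤ a ∧ x' ≤ a := by
      rcases hO.total_of_le (hlt x hx y hy).le (hlt x' hx' y hy).le with h | h
      · exact ⟨x', hx', h, le_rfl⟩
      · exact ⟨x, hx, le_rfl, h⟩
    have h2 : ∃ b ∈ Y, b ≤ y ∧ b ≤ y' := by
      rcases hO.total_of_ge (hlt x hx y hy).le (hlt x hx y' hy').le with h | h
      · exact ⟨y, hy, le_rfl, h⟩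
      · exact ⟨y', hy', h, le_rfl⟩
    obtain ⟨a, ha, ha1, ha2⟩ := h1
    obtain ⟨b, hb, hb1, hb2⟩ := h2
    exact ⟨_, ⟨a, ha, b, hb, rfl⟩, Set.Ioo_subset_Ioo ha1 hb1, Set.Ioo_subset_Ioo ha2 hb2⟩
  · rintro s ⟨x, hx, y, hy, rfl⟩
    have h := sub_pos.2 (hlt x hx y hy)
    have h' : y = x + (y - x) := by abel
    refine ⟨x + (1 / 2 : ℚ) • (y - x), lt_add_of_pos_right _ (smul_pos (by norm_num) h), ?_⟩
    conv_rhs => rw [h']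
    exact add_lt_add_right (smul_lt_of_lt_one_left h (by norm_num)) x

/-- An element outside the domain is either comparable with something in it, and then, since `e` is
in the domain, bounded there on both sides, so that its cut can be transported and filled; or it is
incomparable with all of the domain, and any element generic over the range will do. -/
theorem IsPartialIso.exists_sameCut {Γ : Submodule ℚ (M × M)} (h : IsPartialIso e Γ)
    (hO : IsOrderedModel e) (hs : IsSaturated langAddI M κ) (hΓ : #Γ < κ) (y : M) :
    ∃ y', SameCut Γ y y' := by
  have hmem : ∀ p ∈ Γ, p.2 ∈ Γ.map (LinearMap.snd ℚ M M) := fun p hp => ⟨p, hp, rfl⟩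
  by_cases hdom : ∃ p ∈ Γ, p.1 = y
  · obtain ⟨p, hp, rfl⟩ := hdom
    exact ⟨p.2, fun r hr => ⟨h.le_iff hr hp, h.le_iff hp hr⟩⟩
  push Not at hdom
  by_cases hcmp : ∃ p ∈ Γ, p.1 ≤ y ∨ y ≤ p.1
  · have h1 : ∃ p ∈ Γ, p.1 < y := by
      obtain ⟨p, hp, hpy | hpy⟩ := hcmp
      · exact ⟨p, hp, lt_of_le_of_ne hpy (hdom p hp)⟩
      · obtain ⟨n, hn⟩ := hO.exists_le_add hpy
        have := Γ.sub_mem hp (h.smul_unit_mem n)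
        exact ⟨_, this, lt_of_le_of_ne (sub_le_iff_le_add.2 hn) (hdom _ this)⟩
    have h2 : ∃ p ∈ Γ, y < p.1 := by
      obtain ⟨p, hp, hpy⟩ := h1
      obtain ⟨n, hn⟩ := hO.exists_le_add hpy.le
      have := Γ.add_mem hp (h.smul_unit_mem n)
      exact ⟨_, this, lt_of_le_of_ne hn (hdom _ this).symm⟩
    obtain ⟨p₀, hp₀, hp₀y⟩ := h1
    obtain ⟨r₀, hr₀, hr₀y⟩ := h2
    obtain ⟨z, hz1, hz2⟩ := hO.exists_between hs (mk_map_snd_lt hΓ)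
      (X := {x | ∃ p ∈ Γ, p.1 < y ∧ p.2 = x}) (Y := {x | ∃ p ∈ Γ, y < p.1 ∧ p.2 = x})
      (by rintro _ ⟨p, hp, -, rfl⟩; exact hmem p hp)
      (by rintro _ ⟨p, hp, -, rfl⟩; exact hmem p hp)
      ⟨_, p₀, hp₀, hp₀y, rfl⟩ ⟨_, r₀, hr₀, hr₀y, rfl⟩
      (by rintro _ ⟨p, hp, hpy, rfl⟩ _ ⟨r, hr, hry, rfl⟩
          exact (h.lt_iff hp hr).1 (hpy.trans hry))
    have hlt : ∀ p ∈ Γ, p.1 < y → p.2 < z := fun p hp hpy => hz1 _ ⟨p, hp, hpy, rfl⟩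
    have hgt : ∀ p ∈ Γ, y < p.1 → z < p.2 := fun p hp hpy => hz2 _ ⟨p, hp, hpy, rfl⟩
    refine ⟨z, fun p hp => ⟨⟨fun hpy => (hlt p hp (lt_of_le_of_ne hpy (hdom p hp))).le,
      fun hpz => ?_⟩, ⟨fun hpy => (hgt p hp (lt_of_le_of_ne hpy (hdom p hp).symm)).le,
      fun hpz => ?_⟩⟩⟩
    -- Comparability of `p.1` with `y` is not automatic; it comes from the common upper bound
    -- `r₀.1`.
    · have h3 : p.1 ≤ r₀.1 := (h.le_iff hp hr₀).2 (hpz.trans (hgt r₀ hr₀ hr₀y).le)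
      rcases hO.total_of_le h3 hr₀y.le with h4 | h4
      · exact h4
      · exact absurd (hgt p hp (lt_of_le_of_ne h4 (hdom p hp).symm)) (not_lt_of_ge hpz)
    · have h3 : p₀.1 ≤ p.1 := (h.le_iff hp₀ hp).2 ((hlt p₀ hp₀ hp₀y).le.trans hpz)
      rcases hO.total_of_ge h3 hp₀y.le with h4 | h4
      · exact absurd (hlt p hp (lt_of_le_of_ne h4 (hdom p hp))) (not_lt_of_ge hpz)
      · exact h4
  · push Not at hcmp
    obtain ⟨z, hz⟩ := hO.exists_generic hs (mk_map_snd_lt hΓ) (hmem _ h.unit_mem)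
    exact ⟨z, fun p hp => ⟨iff_of_false (hcmp p hp).1 (hz _ (hmem p hp)).1,
      iff_of_false (hcmp p hp).2 (hz _ (hmem p hp)).2⟩⟩

/-- Back-and-forth: at a quantifier the graph grows by one pair and stays small; the backward
direction uses the inverse graph. -/
theorem IsPartialIso.realize_iff (hO : IsOrderedModel e) (hκ : ℵ₀ < κ)
    (hs : IsSaturated langAddI M κ) {α : Type*} {n : ℕ} (φ : langAddI.BoundedFormula α n)
    {Γ : Submodule ℚ (M × M)} (h : IsPartialIso e Γ) (hΓ : #Γ < κ) {v v' : α → M}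
    {xs xs' : Fin n → M} (hv : ∀ i, (v i, v' i) ∈ Γ) (hxs : ∀ i, (xs i, xs' i) ∈ Γ) :
    φ.Realize v xs ↔ φ.Realize v' xs' := by
  have hsum : ∀ {n : ℕ} {xs xs' : Fin n → M}, (∀ i, (xs i, xs' i) ∈ Γ) →
      ∀ i, (Sum.elim v xs i, Sum.elim v' xs' i) ∈ Γ := fun hxs i => by
    rcases i with i | i
    · exact hv i
    · exact hxs i
  induction φ generalizing Γ with
  | falsum => exact Iff.rfl
  | equal t₁ t₂ =>
    exact h.eq_iff (hO.realize_term_mem t₁ (hsum hxs)) (hO.realize_term_mem t₂ (hsum hxs))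
  | rel R ts =>
    cases R with
    | unit =>
      have hR : ∀ x : Fin 1 → M, Structure.RelMap (L := langAddI) AddIRel.unit x ↔
          0 ≤ x 0 ∧ x 0 ≤ e := fun x => by
        rw [← hO.unit_iff]
        refine iff_of_eq (congrArg _ ?_)
        ext i
        fin_cases i
        rfl
      have ht := hO.realize_term_mem (ts 0) (hsum hxs)
      change Structure.RelMap (L := langAddI) AddIRel.unit _ ↔
        Structure.RelMap (L := langAddI) AddIRel.unit _
      rw [hR, hR]
      exact and_congr (h.nonneg_iff _ ht) (h.le_iff ht h.unit_mem)
  | imp φ ψ ih₁ ih₂ =>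
    exact imp_congr (ih₁ h hΓ hv hxs hsum) (ih₂ h hΓ hv hxs hsum)
  | all φ ih =>
    have step : ∀ {y y' : M}, SameCut Γ y y' →
        (φ.Realize v (Fin.snoc xs y) ↔ φ.Realize v' (Fin.snoc xs' y')) := fun {y y'} hy => by
      have hv' : ∀ i, (v i, v' i) ∈ Γ ⊔ Submodule.span ℚ {(y, y')} :=
        fun i => Submodule.mem_sup_left (hv i)
      refine ih (h.extend hy) (mk_sup_span_singleton_lt hκ hΓ _) hv' ?_ ?_
      · refine Fin.lastCases ?_ fun i => ?_
        · simpa using Submodule.mem_sup_right (Submodule.mem_span_singleton_self _)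
        · simpa using Submodule.mem_sup_left (hxs i)
      · intro n xs xs' hxs i
        rcases i with i | i
        · exact hv' i
        · exact hxs i
    simp only [BoundedFormula.realize_all]
    constructor
    · intro H y'
      obtain ⟨y, hy⟩ := h.swap.exists_sameCut hO hs (mk_swapGraph.trans_lt hΓ) y'
      exact (step hy.of_swapGraph).1 (H y)
    · intro H y
      obtain ⟨y', hy⟩ := h.exists_sameCut hO hs hΓ y
      exact (step hy).2 (H y')

/-- In a monster model, a small partial isomorphism extends to an automorphism. -/
theorem IsPartialIso.exists_equiv (hO : IsOrderedModel e) (hκ : ℵ₀ < κ)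
    (hs : IsSaturated langAddI M κ) (hh : IsStronglyHomogeneous langAddI M κ)
    {Γ : Submodule ℚ (M × M)} (h : IsPartialIso e Γ) (hΓ : #Γ < κ) :
    ∃ σ : M ≃[langAddI] M, ∀ p ∈ Γ, σ p.1 = p.2 := by
  have hf : ∀ a : Γ.map (LinearMap.fst ℚ M M), ∃ b : M, ((a : M), b) ∈ Γ := by
    rintro ⟨-, ⟨p, hp, rfl⟩⟩
    exact ⟨p.2, hp⟩
  choose f hf using hf
  obtain ⟨σ, hσ⟩ := hh (Γ.map (LinearMap.fst ℚ M M) : Submodule ℚ M) f (mk_map_fst_lt hΓ)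
    fun φ => h.realize_iff hO hκ hs φ hΓ hf fun i => i.elim0
  refine ⟨σ, fun p hp => ?_⟩
  have hp1 : p.1 ∈ Γ.map (LinearMap.fst ℚ M M) := ⟨p, hp, rfl⟩
  exact (hσ ⟨p.1, hp1⟩).trans ((h.eq_iff (hf ⟨p.1, hp1⟩) hp).1 rfl)

end Saturated

/-! ### Infinitesimals and automorphisms -/

section Aut

variable {M : Type w} [langAddI.Structure M] [AddCommGroup M] [Module ℚ M] [PartialOrder M]
  {e : M}

/-- An automorphism, as a linear map. -/
noncomputable def IsOrderedModel.linearMap (hO : IsOrderedModel e) (σ : M ≃[langAddI] M) :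
    M →ₗ[ℚ] M :=
  AddMonoidHom.toRatLinearMap (AddMonoidHom.mk' σ fun x y => by
    rw [← hO.funMap_add, ← hO.funMap_add, StrongHomClass.map_fun]
    congr 1
    ext i
    fin_cases i <;> rfl)

theorem IsOrderedModel.linearMap_apply (hO : IsOrderedModel e) (σ : M ≃[langAddI] M) (x : M) :
    hO.linearMap σ x = σ x := rfl

theorem IsOrderedModel.equiv_sub (hO : IsOrderedModel e) (σ : M ≃[langAddI] M) (x y : M) :
    σ (x - y) = σ x - σ y := map_sub (hO.linearMap σ) x y

theorem IsOrderedModel.equiv_smul (hO : IsOrderedModel e) (σ : M ≃[langAddI] M) (q : ℚ) (x : M) :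
    σ (q • x) = q • σ x := map_smul (hO.linearMap σ) q x

theorem IsOrderedModel.unit_equiv_iff (hO : IsOrderedModel e) (σ : M ≃[langAddI] M) (x : M) :
    0 ≤ σ x ∧ σ x ≤ e ↔ 0 ≤ x ∧ x ≤ e := by
  rw [← hO.unit_iff, ← hO.unit_iff, ← StrongHomClass.map_rel σ unitSymb (![x])]
  refine iff_of_eq (congrArg _ ?_)
  ext i
  fin_cases i
  rfl

theorem IsOrderedModel.equiv_linearCombination (hO : IsOrderedModel e) {β : Type*} {b b' : β → M}
    {σ : M ≃[langAddI] M} (hσ : ∀ p, σ (b p) = b' p) (c : β →₀ ℚ) :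
    σ (Finsupp.linearCombination ℚ b c) = Finsupp.linearCombination ℚ b' c := by
  rw [← hO.linearMap_apply, Finsupp.apply_linearCombination]
  congr 2
  exact funext hσ

variable [IsOrderedAddMonoid M] [PosSMulStrictMono ℚ M]

/-- A positive element is bounded by some `(n + 1) • e`, so dividing by `n + 1` puts it in `I`,
which automorphisms preserve. -/
theorem IsOrderedModel.equiv_nonneg (hO : IsOrderedModel e) (σ : M ≃[langAddI] M) {x : M}
    (hx : 0 ≤ x) : 0 ≤ σ x := by
  obtain ⟨n, hn⟩ := hO.arch x hx
  have hn' : x ≤ ((n : ℚ) + 1) • e :=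
    hn.trans (smul_le_smul_of_nonneg_right (by linarith) hO.pos.le)
  have hpos : (0 : ℚ) < n + 1 := by positivity
  have h := ((hO.unit_equiv_iff σ (((n : ℚ) + 1)⁻¹ • x)).2
    ⟨smul_nonneg (by positivity) hx, (inv_smul_le_iff_of_pos hpos).2 hn'⟩).1
  rw [hO.equiv_smul] at h
  exact (smul_nonneg_iff_nonneg_of_pos_left (inv_pos.2 hpos)).1 h

theorem IsOrderedModel.equiv_le_iff (hO : IsOrderedModel e) (σ : M ≃[langAddI] M) {x y : M} :
    σ x ≤ σ y ↔ x ≤ y := by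
  rw [← sub_nonneg, ← hO.equiv_sub, ← sub_nonneg (a := y)]
  refine ⟨fun h => ?_, hO.equiv_nonneg σ⟩
  have := hO.equiv_nonneg σ.symm h
  rwa [FirstOrder.Language.Equiv.symm_apply_apply] at this

theorem IsOrderedModel.equiv_unit (hO : IsOrderedModel e) (σ : M ≃[langAddI] M) : σ e = e := by
  refine le_antisymm ((hO.unit_equiv_iff σ e).2 ⟨hO.pos.le, le_rfl⟩).2 ?_
  have h := ((hO.unit_equiv_iff σ.symm e).2 ⟨hO.pos.le, le_rfl⟩).2
  rw [← hO.equiv_le_iff σ, FirstOrder.Language.Equiv.apply_symm_apply] at h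
  exact h

theorem IsOrderedModel.equiv_smul_unit (hO : IsOrderedModel e) (σ : M ≃[langAddI] M) (q : ℚ) :
    σ (q • e) = q • e := by
  rw [hO.equiv_smul, hO.equiv_unit]

end Aut

section DiagGraph

variable {M : Type w} [AddCommGroup M] [Module ℚ M]

/-- The identity graph of a subspace. -/
def diagGraph (W : Submodule ℚ M) : Submodule ℚ (M × M) :=
  W.map (LinearMap.id.prod LinearMap.id)

theorem mk_mem_diagGraph {W : Submodule ℚ M} {w : M} (hw : w ∈ W) : (w, w) ∈ diagGraph W :=
  ⟨w, hw, rfl⟩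

theorem mk_diagGraph_lt {κ : Cardinal.{w}} {W : Submodule ℚ M} (hW : #W < κ) :
    #(diagGraph W) < κ :=
  (mk_image_le (f := LinearMap.id.prod LinearMap.id) (s := (W : Set M))).trans_lt hW

theorem isPartialIso_diagGraph [PartialOrder M] {e : M} {W : Submodule ℚ M} (he : e ∈ W) :
    IsPartialIso e (diagGraph W) :=
  ⟨mk_mem_diagGraph he, by rintro - ⟨w, -, rfl⟩; exact Iff.rfl⟩

end DiagGraph

/-! ### The subgroup of infinitesimals and cuts just above it -/

section Infinitesimal

variable {M : Type w} [langAddI.Structure M] [AddCommGroup M] [Module ℚ M] [PartialOrder M]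
  [IsOrderedAddMonoid M] [PosSMulStrictMono ℚ M] {e : M}

/-- The subgroup of the elements lying between `-(q • e)` and `q • e` for all `q > 0`. -/
def IsOrderedModel.infSubgroup (hO : IsOrderedModel e) : AddSubgroup M where
  carrier := {x | ∀ q : ℚ, 0 < q → -(q • e) ≤ x ∧ x ≤ q • e}
  add_mem' {x y} hx hy q hq := by
    have h : q • e = (q / 2) • e + (q / 2) • e := by rw [← add_smul, add_halves]
    rw [h, neg_add]
    exact ⟨add_le_add (hx _ (half_pos hq)).1 (hy _ (half_pos hq)).1,
      add_le_add (hx _ (half_pos hq)).2 (hy _ (half_pos hq)).2⟩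
  zero_mem' q hq :=
    ⟨neg_nonpos.2 (smul_nonneg hq.le hO.pos.le), smul_nonneg hq.le hO.pos.le⟩
  neg_mem' {x} hx q hq := ⟨neg_le_neg (hx q hq).2, neg_le.1 (hx q hq).1⟩

theorem IsOrderedModel.total_of_mem_infSubgroup (hO : IsOrderedModel e) {x y : M}
    (hx : x ∈ hO.infSubgroup) (hy : y ∈ hO.infSubgroup) : x ≤ y ∨ y ≤ x :=
  hO.total_of_le (hx 1 one_pos).2 (hy 1 one_pos).2

theorem IsOrderedModel.mem_starInterval_iff (hO : IsOrderedModel e) {n : ℕ} (hn : 1 ≤ n) {x : M} :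
    x ∈ starInterval M n ↔ -((1 / n : ℚ) • e) ≤ x ∧ x ≤ (1 / n : ℚ) • e := by
  have hn' : (0 : ℚ) < n := by exact_mod_cast hn
  have h1 : x ≤ (1 / n : ℚ) • e ↔ n • x ≤ e := by
    rw [one_div, le_inv_smul_iff_of_pos hn', Nat.cast_smul_eq_nsmul]
  have h2 : -((1 / n : ℚ) • e) ≤ x ↔ -e ≤ n • x := by
    rw [one_div, ← smul_neg, inv_smul_le_iff_of_pos hn', Nat.cast_smul_eq_nsmul]
  have he : -e ≤ 0 := neg_nonpos.2 hO.pos.le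
  rw [h1, h2]
  change Structure.RelMap unitSymb ![n • x] ∨ Structure.RelMap unitSymb ![-(n • x)] ↔ _
  rw [hO.unit_iff, hO.unit_iff, neg_nonneg, neg_le]
  constructor
  · rintro (⟨h3, h4⟩ | ⟨h3, h4⟩)
    · exact ⟨he.trans h3, h4⟩
    · exact ⟨h4, h3.trans hO.pos.le⟩
  · rintro ⟨h3, h4⟩
    rcases hO.total_of_ge he h3 with h5 | h5
    · exact Or.inl ⟨h5, h4⟩
    · exact Or.inr ⟨h5, h3⟩

theorem IsOrderedModel.coe_infSubgroup (hO : IsOrderedModel e) :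
    (hO.infSubgroup : Set M) = infinitesimals M := by
  ext x
  simp only [infinitesimals, Set.mem_iInter]
  constructor
  · intro h n hn
    have hn' : (0 : ℚ) < n := by exact_mod_cast hn
    exact (hO.mem_starInterval_iff hn).2 (h _ (by positivity))
  · intro h q hq
    obtain ⟨n, hn⟩ := exists_nat_one_div_lt hq
    have h1 := (hO.mem_starInterval_iff (by omega)).1 (h (n + 1) (by omega))
    have h2 : (1 / (n + 1 : ℕ) : ℚ) • e ≤ q • e :=
      smul_le_smul_of_nonneg_right (by push_cast; exact hn.le) hO.pos.le
    exact ⟨(neg_le_neg h2).trans h1.1, h1.2.trans h2⟩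

theorem IsOrderedModel.equiv_mem_infSubgroup_iff (hO : IsOrderedModel e) (σ : M ≃[langAddI] M)
    {x : M} : σ x ∈ hO.infSubgroup ↔ x ∈ hO.infSubgroup := by
  refine forall₂_congr fun q _ => ?_
  rw [← neg_smul, ← hO.equiv_le_iff σ (x := x) (y := q • e),
    ← hO.equiv_le_iff σ (x := (-q) • e) (y := x), hO.equiv_smul_unit, hO.equiv_smul_unit]

/-- Automorphisms move bounded elements by infinitesimals. -/
theorem IsOrderedModel.equiv_sub_mem_infSubgroup (hO : IsOrderedModel e) (σ : M ≃[langAddI] M)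
    {x : M} (hx : x ≤ 0 ∨ 0 ≤ x) : σ x - x ∈ hO.infSubgroup := by
  have key : ∀ x : M, 0 ≤ x → σ x - x ∈ hO.infSubgroup := by
    intro x hx q hq
    -- Trap `x` between rational multiples of `e` at distance `q`, using the least `n` with `x ≤ (n
    -- * q) • e`. These endpoints are fixed by `σ`, so `σ x` is trapped too.
    obtain ⟨r, h1, h2⟩ : ∃ r : ℚ, r • e ≤ x ∧ x ≤ (r + q) • e := by
      obtain ⟨N, hN⟩ := hO.arch x hx
      have hex : ∃ n : ℕ, x ≤ ((n : ℚ) * q) • e := by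
        obtain ⟨n, hn⟩ := exists_nat_ge ((N : ℚ) / q)
        exact ⟨n, hN.trans (smul_le_smul_of_nonneg_right ((div_le_iff₀ hq).1 hn) hO.pos.le)⟩
      classical
      rcases Nat.eq_zero_or_pos (Nat.find hex) with h0 | h0
      · have h3 := Nat.find_spec hex
        rw [h0, Nat.cast_zero, zero_mul, zero_smul] at h3
        exact ⟨0, by rwa [zero_smul], h3.trans (smul_nonneg (by linarith) hO.pos.le)⟩
      · obtain ⟨m, hm⟩ := Nat.exists_eq_succ_of_ne_zero h0.ne'
        have h3 := Nat.find_spec hex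
        have h4 := Nat.find_min hex (m := m) (by omega)
        refine ⟨m * q, ?_, ?_⟩
        · have h5 : (0 : M) ≤ ((m : ℚ) * q) • e := smul_nonneg (by positivity) hO.pos.le
          exact (hO.total_of_ge h5 hx).resolve_right h4
        · rw [hm] at h3
          push_cast at h3
          rwa [add_mul, one_mul] at h3
    have h3 := (hO.equiv_le_iff σ).2 h1
    have h4 := (hO.equiv_le_iff σ).2 h2
    rw [hO.equiv_smul_unit, add_smul] at h4
    rw [hO.equiv_smul_unit] at h3
    rw [add_smul] at h2
    constructor
    · rw [neg_le, neg_sub, sub_le_iff_le_add]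
      exact h2.trans (by rw [add_comm]; gcongr)
    · rw [sub_le_iff_le_add]
      exact h4.trans (by rw [add_comm]; gcongr)
  rcases hx with hx | hx
  · have h := hO.infSubgroup.neg_mem (key (-x) (neg_nonneg.2 hx))
    have h' : σ (-x) = -σ x := map_neg (hO.linearMap σ) x
    rw [h'] at h
    convert h using 1
    abel
  · exact key x hx

variable {κ : Cardinal.{w}}

/-- The identity of `W` extended by `y ↦ y'` is a small partial isomorphism, so equal cuts over `W`
give equal types over `W`. -/
theorem IsOrderedModel.exists_equiv_fixing (hO : IsOrderedModel e) (hκ : ℵ₀ < κ)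
    (hs : IsSaturated langAddI M κ) (hh : IsStronglyHomogeneous langAddI M κ)
    {W : Submodule ℚ M} (he : e ∈ W) (hW : #W < κ) {y y' : M}
    (hy : ∀ w ∈ W, (w ≤ y ↔ w ≤ y') ∧ (y ≤ w ↔ y' ≤ w)) :
    ∃ σ : M ≃[langAddI] M, (∀ w ∈ W, σ w = w) ∧ σ y = y' := by
  have hcut : SameCut (diagGraph W) y y' := by
    rintro - ⟨w, hw, rfl⟩
    exact hy w hw
  obtain ⟨σ, hσ⟩ := ((isPartialIso_diagGraph he).extend hcut).exists_equiv hO hκ hs hh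
    (mk_sup_span_singleton_lt hκ (mk_diagGraph_lt hW) _)
  exact ⟨σ, fun w hw => hσ _ (Submodule.mem_sup_left (mk_mem_diagGraph hw)),
    hσ _ (Submodule.mem_sup_right (Submodule.mem_span_singleton_self _))⟩

/-- `y` is infinitesimal and greater than every infinitesimal element of `W`. -/
structure IsOrderedModel.IsAboveInf (hO : IsOrderedModel e) (W : Submodule ℚ M) (y : M) : Prop where
  mem : y ∈ hO.infSubgroup
  lt : ∀ w ∈ W, w ∈ hO.infSubgroup → w < y

namespace IsOrderedModel.IsAboveInf

variable {hO : IsOrderedModel e} {W : Submodule ℚ M} {y : M}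

theorem pos (h : hO.IsAboveInf W y) : 0 < y := h.lt 0 W.zero_mem hO.infSubgroup.zero_mem

theorem mono (h : hO.IsAboveInf W y) {V : Submodule ℚ M} (hV : V ≤ W) : hO.IsAboveInf V y :=
  ⟨h.mem, fun w hw => h.lt w (hV hw)⟩

/-- The right-hand side does not mention `y`: together with `ge_iff`, it shows that all such `y`
fill the same cut of `W`. -/
theorem le_iff (h : hO.IsAboveInf W y) {w : M} (hw : w ∈ W) :
    w ≤ y ↔ ∀ q : ℚ, 0 < q → w ≤ q • e := by
  refine ⟨fun hwy q hq => hwy.trans (h.mem q hq).2, fun hwq => ?_⟩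
  by_cases hw' : ∀ q : ℚ, 0 < q → -(q • e) ≤ w
  · exact (h.lt w hw fun q hq => ⟨hw' q hq, hwq q hq⟩).le
  · push Not at hw'
    obtain ⟨q, hq, hqw⟩ := hw'
    have h1 : -(q • e) ≤ q • e := by
      have := smul_nonneg hq.le hO.pos.le
      exact (neg_nonpos.2 this).trans this
    have h2 := (hO.total_of_le h1 (hwq q hq)).resolve_left hqw
    exact h2.trans (h.mem q hq).1

theorem ge_iff (h : hO.IsAboveInf W y) {w : M} (hw : w ∈ W) :
    y ≤ w ↔ ∃ q : ℚ, 0 < q ∧ q • e ≤ w := by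
  constructor
  · intro hyw
    by_contra! hne
    refine (h.lt w hw fun q hq => ⟨?_, ?_⟩).not_ge hyw
    · exact (neg_nonpos.2 (smul_nonneg hq.le hO.pos.le)).trans (h.pos.le.trans hyw)
    · exact (hO.total_of_ge (smul_nonneg hq.le hO.pos.le)
        (h.pos.le.trans hyw)).resolve_left (hne q hq)
  · rintro ⟨q, hq, hqw⟩
    exact (h.mem q hq).2.trans hqw

end IsOrderedModel.IsAboveInf

theorem IsOrderedModel.exists_isAboveInf (hO : IsOrderedModel e)
    (hs : IsSaturated langAddI M κ) {W : Submodule ℚ M} (he : e ∈ W) (hW : #W < κ) :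
    ∃ y, hO.IsAboveInf W y := by
  obtain ⟨y, hy1, hy2⟩ := hO.exists_between hs hW (X := {x | x ∈ W ∧ x ∈ hO.infSubgroup})
    (Y := {x | ∃ q : ℚ, 0 < q ∧ q • e = x}) (fun x hx => hx.1)
    (by rintro - ⟨q, -, rfl⟩; exact W.smul_mem q he)
    ⟨0, W.zero_mem, hO.infSubgroup.zero_mem⟩ ⟨_, 1, one_pos, rfl⟩
    (by
      rintro x ⟨-, hx⟩ - ⟨q, hq, rfl⟩
      refine (hx _ (half_pos hq)).2.trans_lt ?_
      exact smul_lt_smul_of_pos_right (half_lt_self hq) hO.pos)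
  have h0 := hy1 0 ⟨W.zero_mem, hO.infSubgroup.zero_mem⟩
  exact ⟨y, fun q hq => ⟨(neg_nonpos.2 (smul_nonneg hq.le hO.pos.le)).trans h0.le,
    (hy2 _ ⟨q, hq, rfl⟩).le⟩, fun w hw hw' => hy1 w ⟨hw, hw'⟩⟩

theorem IsPartialIso.sameCut_of_isAboveInf {hO : IsOrderedModel e} {Γ : Submodule ℚ (M × M)}
    (h : IsPartialIso e Γ) {W W' : Submodule ℚ M} (hΓ : ∀ p ∈ Γ, p.1 ∈ W ∧ p.2 ∈ W') {y y' : M}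
    (hy : hO.IsAboveInf W y) (hy' : hO.IsAboveInf W' y') : SameCut Γ y y' := fun p hp => by
  rw [hy.le_iff (hΓ p hp).1, hy'.le_iff (hΓ p hp).2, hy.ge_iff (hΓ p hp).1,
    hy'.ge_iff (hΓ p hp).2]
  exact ⟨forall₂_congr fun q _ => h.le_iff hp (h.smul_unit_mem q),
    exists_congr fun q => and_congr_right fun _ => h.le_iff (h.smul_unit_mem q) hp⟩

end Infinitesimal

/-! ### Invariance -/

section Invariance

variable {L : FirstOrder.Language.{u, v}} {M : Type w} [L.Structure M] {A X : Set M}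

theorem InvariantOver.mem_iff (h : InvariantOver L A X) {σ : M ≃[L] M} (hσ : ∀ c ∈ A, σ c = c)
    (x : M) : σ x ∈ X ↔ x ∈ X := by
  conv_lhs => rw [← h σ hσ]
  exact σ.injective.mem_set_image

theorem invariantOver_of_mem_imp
    (h : ∀ σ : M ≃[L] M, (∀ c ∈ A, σ c = c) → ∀ x ∈ X, σ x ∈ X) : InvariantOver L A X := by
  intro σ hσ
  refine Set.Subset.antisymm (Set.image_subset_iff.2 (h σ hσ)) fun x hx => ?_
  refine ⟨σ.symm x, h σ.symm (fun c hc => ?_) x hx, FirstOrder.Language.Equiv.apply_symm_apply σ x⟩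
  conv_lhs => rw [← hσ c hc]
  exact FirstOrder.Language.Equiv.symm_apply_apply σ c

theorem invariantOver_of_definable (h : A.Definable₁ L X) : InvariantOver L A X := by
  obtain ⟨φ, hφ⟩ := Set.definable_iff_exists_formula_sum.1 h
  refine invariantOver_of_mem_imp fun σ hσ x hx => ?_
  have key : ∀ z : M, z ∈ X ↔ φ.Realize (Sum.elim ((↑) : A → M) (fun _ : Fin 1 => z)) := fun z =>
    Set.ext_iff.1 hφ fun _ => z
  rw [key, ← StrongHomClass.realize_formula σ] at hx
  rw [key]
  convert hx using 1
  ext (a | i)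
  · exact (hσ a a.2).symm
  · rfl

theorem TypeDefinable.invariantOver (h : TypeDefinable L A X) : InvariantOver L A X := by
  obtain ⟨S, hS, rfl⟩ := h
  exact invariantOver_of_mem_imp fun σ hσ x hx s hs =>
    ((invariantOver_of_definable (hS s hs)).mem_iff hσ x).2 (hx s hs)

theorem TypeDefinable.of_definable (h : A.Definable₁ L X) : TypeDefinable L A X :=
  ⟨{X}, by simpa using h, by simp⟩

theorem SameType.symm {E : Setoid M} {ι γ : Type*} {x x' : ι → Quotient E} {y y' : γ → M}
    (h : SameType L A E x y x' y') : SameType L A E x' y' x y := by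
  obtain ⟨σ, h1, h2, h3⟩ := h
  have hs : ∀ {a b : M}, σ a = b → σ.symm b = a := fun {a b} h => by
    rw [← h, FirstOrder.Language.Equiv.symm_apply_apply]
  refine ⟨σ.symm, fun c hc => hs (h1 c hc), fun i => ?_, fun j => hs (h3 j)⟩
  rw [← h2 i]
  ext m
  constructor
  · rintro ⟨-, ⟨m, hm, rfl⟩, rfl⟩
    rwa [FirstOrder.Language.Equiv.symm_apply_apply]
  · intro hm
    exact ⟨σ m, ⟨m, hm, rfl⟩, FirstOrder.Language.Equiv.symm_apply_apply σ m⟩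

theorem IsMonster.aleph0_lt {κ : Cardinal.{w}} (h : IsMonster L M κ) : ℵ₀ < κ := by
  have h1 : Cardinal.lift.{max u v} ℵ₀ < Cardinal.lift.{max u v} κ := by
    refine lt_of_le_of_lt ?_ h.card_lt
    rw [lift_max, lift_aleph0, lift_aleph0]
    exact le_max_left _ _
  exact lift_lt.1 h1

theorem IsMonster.mk_insert_lt {κ : Cardinal.{w}} (hM : IsMonster L M κ) (hA : #A < κ) (x : M) :
    #(insert x A : Set M) < κ :=
  mk_insert_le.trans_lt (add_lt_of_lt hM.aleph0_lt.le hA (one_lt_aleph0.trans hM.aleph0_lt))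

end Invariance

/-! ### Subgroups of bounded index and definable subgroups -/

section Model

variable {M : Type w} [langAddI.Structure M] [AddCommGroup M] [Module ℚ M] [PartialOrder M]
  {e : M} {κ : Cardinal.{w}}

theorem IsOrderedModel.image_coset_eq_iff (hO : IsOrderedModel e) {H : AddSubgroup M}
    {σ : M ≃[langAddI] M} (hH : ∀ x, σ x ∈ H ↔ x ∈ H) (x y : M) :
    σ '' {m | Quotient.mk (QuotientAddGroup.leftRel H) m = Quotient.mk _ x} =
      {m | Quotient.mk (QuotientAddGroup.leftRel H) m = Quotient.mk _ y} ↔ σ x - y ∈ H := by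
  have hq : ∀ a b : M, Quotient.mk (QuotientAddGroup.leftRel H) a = Quotient.mk _ b ↔
      a - b ∈ H := fun a b => by
    rw [Quotient.eq, QuotientAddGroup.leftRel_apply, ← H.neg_mem_iff]
    simp [sub_eq_add_neg, add_comm]
  constructor
  · intro h
    have : σ x ∈ {m | Quotient.mk (QuotientAddGroup.leftRel H) m = Quotient.mk _ y} :=
      h ▸ ⟨x, rfl, rfl⟩
    exact (hq _ _).1 this
  · intro h
    ext m
    have h1 : m - y = (m - σ x) + (σ x - y) := by abel
    have h2 : σ (σ.symm m) = m := FirstOrder.Language.Equiv.apply_symm_apply σ m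
    change _ ↔ Quotient.mk (QuotientAddGroup.leftRel H) m = Quotient.mk _ y
    rw [hq, h1, H.add_mem_cancel_right h, ← h2, ← hO.equiv_sub, hH]
    constructor
    · rintro ⟨k, hk, hkm⟩
      rw [← σ.injective hkm]
      exact (hq _ _).1 hk
    · intro hk
      exact ⟨_, (hq _ _).2 hk, rfl⟩

theorem IsOrderedModel.definable_starInterval (hO : IsOrderedModel e) (n : ℕ) :
    (∅ : Set M).Definable₁ langAddI (starInterval M (n + 1)) := by
  refine Set.empty_definable_iff.2 ⟨unitFormula (nsmulTerm n (var (Sum.inl 0))) ⊔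
    -- Lacking symbols for `0` and `-`, the negative of `(n + 1) • x` is described as the `u` with
    -- `u + (n + 1) • x + x = x`.
    ∃' (unitFormula (&0) ⊓ (addTerm (addTerm (&0) (nsmulTerm n (var (Sum.inl 0))))
      (var (Sum.inl 0)) =' var (Sum.inl 0))), ?_⟩
  ext v
  simp only [Set.mem_ofPred_eq, Formula.Realize, BoundedFormula.realize_ex,
    BoundedFormula.realize_sup, BoundedFormula.realize_inf, realize_unitFormula,
    BoundedFormula.realize_bdEqual, realize_addTerm hO.funMap_add,
    realize_nsmulTerm hO.funMap_add, Term.realize_var, Sum.elim_inl]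
  change Structure.RelMap unitSymb ![(n + 1) • v 0] ∨
      Structure.RelMap unitSymb ![-((n + 1) • v 0)] ↔
    Structure.RelMap unitSymb ![(n + 1) • v 0] ∨
      ∃ u : M, Structure.RelMap unitSymb ![u] ∧ u + (n + 1) • v 0 + v 0 = v 0
  refine or_congr_right ⟨fun h => ⟨_, h, by rw [neg_add_cancel, zero_add]⟩, ?_⟩
  rintro ⟨u, hu, h⟩
  rwa [← eq_neg_of_add_eq_zero_left (add_eq_right.1 h)]

variable [IsOrderedAddMonoid M] [PosSMulStrictMono ℚ M]

theorem IsOrderedModel.comparable_of_add_smul_unit (hO : IsOrderedModel e) {x y : M} {q : ℚ}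
    (h : x + q • e ≤ y ∨ y ≤ x + q • e) : x ≤ y ∨ y ≤ x := by
  have h0 : (0 : M) ≤ |q| • e := smul_nonneg (abs_nonneg q) hO.pos.le
  rcases h with h | h
  · have h1 : x - |q| • e ≤ x + q • e := by
      rw [sub_eq_add_neg, ← neg_smul]
      exact add_le_add_right (smul_le_smul_of_nonneg_right (neg_abs_le q) hO.pos.le) x
    exact hO.total_of_ge (sub_le_self x h0) (h1.trans h)
  · have h1 : x + q • e ≤ x + |q| • e :=
      add_le_add_right (smul_le_smul_of_nonneg_right (le_abs_self q) hO.pos.le) x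
    exact hO.total_of_le (le_add_of_nonneg_right h0) (h.trans h1)

theorem IsOrderedModel.infSubgroup_ne_top (hO : IsOrderedModel e) : hO.infSubgroup ≠ ⊤ := by
  intro h
  have h1 : e ∈ hO.infSubgroup := h ▸ AddSubgroup.mem_top e
  exact (h1 (1 / 2) (by norm_num)).2.not_gt (smul_lt_of_lt_one_left hO.pos (by norm_num))

theorem IsOrderedModel.typeDefinable_infSubgroup (hO : IsOrderedModel e) :
    TypeDefinable langAddI (∅ : Set M) (hO.infSubgroup : Set M) := by
  refine ⟨Set.range fun n : ℕ => starInterval M (n + 1), ?_, ?_⟩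
  · rintro - ⟨n, rfl⟩
    exact hO.definable_starInterval n
  · rw [hO.coe_infSubgroup, Set.sInter_range]
    ext x
    simp only [infinitesimals, Set.mem_iInter]
    exact ⟨fun h n => h (n + 1) (by omega), fun h n hn => by
      obtain ⟨k, rfl⟩ := Nat.exists_eq_add_of_le' hn
      exact h k⟩

/-- An `A`-invariant subgroup contains `x` if it contains an element at unbounded distance from
the span of `A` and `x`. -/
theorem IsOrderedModel.mem_of_generic_mem (hO : IsOrderedModel e)
    (hM : IsMonster langAddI M κ) {A : Set M} {H : AddSubgroup M}
    (hH : InvariantOver langAddI A (H : Set M)) {W : Submodule ℚ M} (he : e ∈ W) (hW : #W < κ)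
    (hA : A ⊆ W) {x h : M} (hx : x ∈ W) (hh : h ∈ H) (hg : ∀ w ∈ W, ¬ w ≤ h ∧ ¬ h ≤ w) :
    x ∈ H := by
  have hg' : ∀ w ∈ W, ¬ w ≤ h + x ∧ ¬ h + x ≤ w := fun w hw => by
    rw [← sub_le_iff_le_add, ← le_sub_iff_add_le]
    exact hg _ (W.sub_mem hw hx)
  obtain ⟨σ, hσ, hσh⟩ := hO.exists_equiv_fixing hM.aleph0_lt hM.saturated hM.homogeneous he hW
    (y := h) (y' := h + x) fun w hw =>
      ⟨iff_of_false (hg w hw).1 (hg' w hw).1, iff_of_false (hg w hw).2 (hg' w hw).2⟩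
  have h1 : h + x ∈ H := hσh ▸ (hH.mem_iff (fun c hc => hσ c (hA hc)) h).2 hh
  exact (H.add_mem_cancel_left hh).1 h1

/-- An invariant subgroup of bounded index is the whole group. -/
theorem IsOrderedModel.eq_top_of_invariantOver (hO : IsOrderedModel e)
    (hM : IsMonster langAddI M κ) {A : Set M} (hA : #A < κ) {H : AddSubgroup M}
    (hH : InvariantOver langAddI A (H : Set M)) (hi : #(M ⧸ H) < κ) : H = ⊤ := by
  refine eq_top_iff.2 fun x _ => ?_
  set R : Set M := Set.range (Quotient.out : M ⧸ H → M)
  have hR : #R < κ := mk_range_le.trans_lt hi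
  set W := Submodule.span ℚ (insert e (insert x (A ∪ R)))
  have hW : #W < κ := mk_span_lt hM.aleph0_lt (hM.mk_insert_lt (hM.mk_insert_lt
    ((mk_union_le _ _).trans_lt (add_lt_of_lt hM.aleph0_lt.le hA hR)) x) e)
  have hsub : insert e (insert x (A ∪ R)) ⊆ (W : Set M) := Submodule.subset_span
  have he : e ∈ W := hsub (by simp)
  -- `W` contains a representative of every coset, so subtracting that of `y` gives an element of
  -- `H` that is still generic over `W`.
  obtain ⟨y, hy⟩ := hO.exists_generic hM.saturated hW he
  set r : M := (QuotientAddGroup.mk y : M ⧸ H).out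
  have hr : r ∈ W := hsub (Or.inr (Or.inr (Or.inr ⟨_, rfl⟩)))
  have hyr : y - r ∈ H := by
    have h1 : (QuotientAddGroup.mk r : M ⧸ H) = QuotientAddGroup.mk y := Quotient.out_eq _
    rw [QuotientAddGroup.eq, neg_add_eq_sub] at h1
    exact h1
  refine hO.mem_of_generic_mem hM hH he hW (fun a ha => hsub (Or.inr (Or.inr (Or.inl ha))))
    (hsub (by simp)) hyr fun w hw => ?_
  rw [le_sub_iff_add_le, sub_le_iff_le_add]
  exact hy _ (W.add_mem hw hr)

/-- A definable subgroup containing the infinitesimals is the whole group. -/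
theorem IsOrderedModel.eq_top_of_definable (hO : IsOrderedModel e)
    (hM : IsMonster langAddI M κ) {A : Set M} (hA : #A < κ) {H : AddSubgroup M}
    (hH : A.Definable₁ langAddI (H : Set M)) (hle : hO.infSubgroup ≤ H) : H = ⊤ := by
  refine eq_top_iff.2 fun x _ => ?_
  set W := Submodule.span ℚ (insert e (insert x A))
  have hW : #W < κ := mk_span_lt hM.aleph0_lt (hM.mk_insert_lt (hM.mk_insert_lt hA x) e)
  have hsub : insert e (insert x A) ⊆ (W : Set M) := Submodule.subset_span
  have he : e ∈ W := hsub (by simp)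
  have hAW : A ⊆ W := fun a ha => hsub (Or.inr (Or.inr ha))
  have hHW : (W : Set M).Definable₁ langAddI (H : Set M) := Set.Definable.mono hH hAW
  -- Otherwise the definable sets `[0, q • e] \ H` are nonempty and directed, and saturation yields
  -- an infinitesimal outside `H`.
  have hε : ∃ ε : ℚ, 0 < ε ∧ ε • e ∈ H := by
    by_contra! hne
    suffices h : (⋂₀ {s | ∃ q : ℚ, 0 < q ∧ s = Set.Icc 0 (q • e) \ (H : Set M)}).Nonempty by
      obtain ⟨z, hz⟩ := h
      simp only [Set.mem_sInter] at hz
      refine (hz _ ⟨1, one_pos, rfl⟩).2 (hle fun q hq => ?_)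
      have h1 := (hz _ ⟨q, hq, rfl⟩).1
      exact ⟨(neg_nonpos.2 (h1.1.trans h1.2)).trans h1.1, h1.2⟩
    refine hM.saturated.nonempty_sInter hW ⟨_, 1, one_pos, rfl⟩ ?_ ?_ ?_
    · rintro s ⟨q, -, rfl⟩
      exact (hO.definable_Icc W.zero_mem (W.smul_mem q he)).sdiff hHW
    · rintro s ⟨q, hq, rfl⟩ t ⟨r, hr, rfl⟩
      refine ⟨_, ⟨min q r, lt_min hq hr, rfl⟩, ?_, ?_⟩ <;>
      refine Set.sdiff_subset_sdiff_left (Set.Icc_subset_Icc_right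
        (smul_le_smul_of_nonneg_right ?_ hO.pos.le))
      · exact min_le_left _ _
      · exact min_le_right _ _
    · rintro s ⟨q, hq, rfl⟩
      exact ⟨q • e, ⟨smul_nonneg hq.le hO.pos.le, le_rfl⟩, hne q hq⟩
  obtain ⟨ε, hε, hεH⟩ := hε
  obtain ⟨h, hhH, hg⟩ := hO.exists_generic_mem hM.saturated hW he hHW hε fun m => by
    rw [Nat.cast_smul_eq_nsmul]
    exact H.nsmul_mem hεH m
  exact hO.mem_of_generic_mem hM (invariantOver_of_definable hH) he hW hAW (hsub (by simp)) hhH hg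

end Model

/-! ### The quotient by the infinitesimals is stable -/

section StableQuotient

variable {M : Type w} [langAddI.Structure M] [AddCommGroup M] [Module ℚ M] [PartialOrder M]
  [IsOrderedAddMonoid M] [PosSMulStrictMono ℚ M] {e : M} {κ : Cardinal.{w}}

/-- Lift `a k` to `α k`, and let `l c k` be the combination of the tuple `b k` with coefficients
`c`. If `α i` is comparable with some `l c j`, then `α i - l c j` is constant modulo `μ` along pairs
of indices in the same order, which forces both `α` and `l c` to agree modulo `μ` at `i` and `j`; an
automorphism taking `b j` to `b i` then does the exchange. If no such comparability holds in either
direction, both elements to be matched are generic over the span of `e` and `b i`. -/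
theorem IsOrderedModel.isStableHyper_infSubgroup (hO : IsOrderedModel e)
    (hM : IsMonster langAddI M κ) :
    IsStableHyper langAddI κ (∅ : Set M) (QuotientAddGroup.leftRel hO.infSubgroup) := by
  set μ := hO.infSubgroup
  intro β hβ a b hind i j hij
  obtain ⟨α, hα⟩ : ∃ α : ℕ → M, ∀ k, Quotient.mk _ (α k) = a k :=
    ⟨fun k => (a k).out, fun k => Quotient.out_eq _⟩
  have hcos : ∀ (σ : M ≃[langAddI] M) (k l : ℕ),
      σ '' {m | Quotient.mk _ m = a k} = {m | Quotient.mk _ m = a l} ↔ σ (α k) - α l ∈ μ :=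
    fun σ k l => by
      rw [← hα, ← hα]
      exact hO.image_coset_eq_iff (fun x => hO.equiv_mem_infSubgroup_iff σ) _ _
  have pair : ∀ {i j k l : ℕ}, i < j → k < l → ∃ σ : M ≃[langAddI] M,
      (σ (α i) - α k ∈ μ ∧ ∀ p, σ (b i p) = b k p) ∧
      (σ (α j) - α l ∈ μ ∧ ∀ p, σ (b j p) = b l p) := by
    intro i j k l hij hkl
    have hmono : ∀ {i j : ℕ}, i < j → StrictMono ![i, j] := fun h => by
      simpa [Fin.strictMono_iff_lt_succ] using h
    obtain ⟨σ, -, h2, h3⟩ := hind 2 ![i, j] ![k, l] (hmono hij) (hmono hkl)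
    exact ⟨σ, ⟨(hcos σ i k).1 (h2 0), fun p => h3 (0, p)⟩,
      (hcos σ j l).1 (h2 1), fun p => h3 (1, p)⟩
  set l : (β →₀ ℚ) → ℕ → M := fun c k => Finsupp.linearCombination ℚ (b k) c
  have hl : ∀ {σ : M ≃[langAddI] M} {k m : ℕ} (c : β →₀ ℚ), (∀ p, σ (b k p) = b m p) →
      σ (l c k) = l c m := fun c h => hO.equiv_linearCombination h c
  -- `α i - l c j` and its images under automorphisms agree modulo infinitesimals
  have move : ∀ {σ : M ≃[langAddI] M} {i j k m : ℕ} {c : β →₀ ℚ}, α i ≤ l c j ∨ l c j ≤ α i →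
      σ (α i) - α k ∈ μ → (∀ p, σ (b j p) = b m p) →
      (α k - l c m) - (α i - l c j) ∈ μ := by
    intro σ i j k m c hc h1 h2
    have h3 := hO.equiv_sub_mem_infSubgroup σ (x := α i - l c j)
      (by rwa [sub_nonpos, sub_nonneg])
    rw [hO.equiv_sub, hl c h2] at h3
    convert μ.sub_mem h3 h1 using 1
    abel
  -- Moving only the larger index up by one isolates the change of one term; moving both indices
  -- gives the other; a third automorphism carries consecutive indices back to `i` and `j`.
  have claim : ∀ {i j : ℕ} {c : β →₀ ℚ}, i ≠ j → α i ≤ l c j ∨ l c j ≤ α i →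
      α i - α j ∈ μ ∧ l c i - l c j ∈ μ := by
    intro i j c hij hc
    rcases lt_or_gt_of_ne hij with hij | hij
    · obtain ⟨σ₁, h1, h1'⟩ := pair hij (Nat.lt_succ_of_lt hij)
      obtain ⟨σ₂, h2, h2'⟩ := pair hij (Nat.lt_succ_self j)
      obtain ⟨σ₃, h3, h3'⟩ := pair (Nat.lt_succ_self j) hij
      have e1 := move hc h1.1 h1'.2
      have e2 := move hc h2.1 h2'.2
      have e3 : l c j - l c (j + 1) ∈ μ := by
        convert e1 using 1
        abel
      have e4 := (hO.equiv_mem_infSubgroup_iff σ₃).2 e3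
      rw [hO.equiv_sub, hl c h3.2, hl c h3'.2] at e4
      refine ⟨?_, e4⟩
      convert μ.sub_mem e3 e2 using 1
      abel
    · obtain ⟨σ₁, h1, h1'⟩ := pair hij (Nat.lt_succ_of_lt hij)
      obtain ⟨σ₂, h2, h2'⟩ := pair hij (Nat.lt_succ_self i)
      obtain ⟨σ₃, h3, h3'⟩ := pair (Nat.lt_succ_self i) hij
      have e1 := move hc h1'.1 h1.2
      have e2 := move hc h2'.1 h2.2
      have e3 : α (i + 1) - α i ∈ μ := by
        convert e1 using 1
        abel
      have e4 := (hO.equiv_mem_infSubgroup_iff σ₃).2 e3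
      rw [hO.equiv_sub] at e4
      constructor
      · convert μ.add_mem (μ.sub_mem e4 h3'.1) h3.1 using 1
        abel
      · convert μ.sub_mem e3 e2 using 1
        abel
  have single : ∀ i j : ℕ, ∃ σ : M ≃[langAddI] M, σ (α i) - α j ∈ μ ∧ ∀ p, σ (b i p) = b j p :=
    fun i j => by
      obtain ⟨σ, h, -⟩ := pair (Nat.lt_succ_self i) (Nat.lt_succ_self j)
      exact ⟨σ, h⟩
  have bounded : ∀ {i j : ℕ} {c : β →₀ ℚ}, i ≠ j → α i ≤ l c j ∨ l c j ≤ α i →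
      SameType langAddI ∅ (QuotientAddGroup.leftRel μ) (fun _ : Unit => a i) (b j)
        (fun _ : Unit => a j) (b i) := by
    intro i j c hij hc
    obtain ⟨h1, h2⟩ := claim hij hc
    obtain ⟨σ, -, hσ⟩ := single j i
    refine ⟨σ, by simp, fun _ => (hcos σ i j).2 ?_, hσ⟩
    have h3 := hO.equiv_sub_mem_infSubgroup σ (x := α i - l c j)
      (by rwa [sub_nonpos, sub_nonneg])
    rw [hO.equiv_sub, hl c hσ] at h3
    convert μ.add_mem (μ.add_mem h3 h2) h1 using 1
    abel
  by_cases hi : ∃ c, α i ≤ l c j ∨ l c j ≤ α i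
  · obtain ⟨c, hc⟩ := hi
    exact bounded hij hc
  by_cases hj : ∃ c, α j ≤ l c i ∨ l c i ≤ α j
  · obtain ⟨c, hc⟩ := hj
    exact (bounded hij.symm hc).symm
  push Not at hi hj
  obtain ⟨σ, -, hσ⟩ := single j i
  set W := Submodule.span ℚ (insert e (Set.range (b i)))
  have hW : #W < κ :=
    mk_span_lt hM.aleph0_lt (hM.mk_insert_lt (mk_range_le.trans_lt hβ) e)
  have hWl : ∀ w ∈ W, ∃ (q : ℚ) (c : β →₀ ℚ), w = l c i + q • e := by
    intro w hw
    obtain ⟨q, z, hz, rfl⟩ := Submodule.mem_span_insert.1 hw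
    obtain ⟨c, rfl⟩ := (Finsupp.mem_span_range_iff_exists_finsupp).1 hz
    exact ⟨q, c, add_comm _ _⟩
  have hgen : ∀ z : M, (∀ c, ¬ z ≤ l c i ∧ ¬ l c i ≤ z) → ∀ w ∈ W, ¬ w ≤ z ∧ ¬ z ≤ w := by
    intro z hz w hw
    obtain ⟨q, c, rfl⟩ := hWl w hw
    rw [← not_or]
    intro h
    exact (hO.comparable_of_add_smul_unit h).elim (hz c).2 (hz c).1
  have g1 := hgen (α j) hj
  have g2 := hgen (σ (α i)) fun c => by
    rw [← hl c hσ, hO.equiv_le_iff, hO.equiv_le_iff]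
    exact hi c
  obtain ⟨τ, hτ, hτα⟩ := hO.exists_equiv_fixing hM.aleph0_lt hM.saturated hM.homogeneous
    (Submodule.subset_span (Set.mem_insert _ _)) hW fun w hw =>
      ⟨iff_of_false (g2 w hw).1 (g1 w hw).1, iff_of_false (g2 w hw).2 (g1 w hw).2⟩
  refine ⟨τ.comp σ, by simp, fun _ => (hcos _ i j).2 ?_, fun p => ?_⟩
  · rw [FirstOrder.Language.Equiv.comp_apply, hτα, sub_self]
    exact μ.zero_mem
  · rw [FirstOrder.Language.Equiv.comp_apply, hσ]
    exact hτ _ (Submodule.subset_span (Or.inr ⟨p, rfl⟩))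

end StableQuotient

/-! ### Subgroups with stable quotient contain the infinitesimals -/

section Least

variable {M : Type w} [langAddI.Structure M] [AddCommGroup M] [Module ℚ M] [PartialOrder M]
  [IsOrderedAddMonoid M] [PosSMulStrictMono ℚ M] {e : M} {κ : Cardinal.{w}}

theorem IsOrderedModel.exists_isAboveInf_seq (hO : IsOrderedModel e)
    (hM : IsMonster langAddI M κ) {V : Submodule ℚ M} (he : e ∈ V) (hV : #V < κ) :
    ∃ (W : ℕ → Submodule ℚ M) (y : ℕ → M), W 0 = V ∧ ∀ k, hO.IsAboveInf (W k) (y k) ∧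
      W (k + 1) = W k ⊔ Submodule.span ℚ {y k} := by
  choose f hf using fun W : {W : Submodule ℚ M // e ∈ W ∧ #W < κ} =>
    hO.exists_isAboveInf hM.saturated W.2.1 W.2.2
  let W : ℕ → {W : Submodule ℚ M // e ∈ W ∧ #W < κ} := fun n => Nat.rec ⟨V, he, hV⟩
    (fun _ W => ⟨W.1 ⊔ Submodule.span ℚ {f W}, Submodule.mem_sup_left W.2.1,
      mk_sup_span_singleton_lt hM.aleph0_lt W.2.2 _⟩) n
  exact ⟨fun n => (W n).1, fun n => f (W n), rfl, fun k => ⟨hf (W k), rfl⟩⟩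

/-- Indiscernibility of the sequence over `W 0`: pairs are added in increasing order, each new
element lying above the infinitesimals of the spaces that contain the graph so far. The bounds by `W
N` and `W N'` keep the induction going. -/
theorem IsOrderedModel.exists_isPartialIso_seq (hO : IsOrderedModel e) (hκ : ℵ₀ < κ)
    {W : ℕ → Submodule ℚ M} {y : ℕ → M} (he : e ∈ W 0) (hW : #(W 0) < κ)
    (hy : ∀ k, hO.IsAboveInf (W k) (y k) ∧ W (k + 1) = W k ⊔ Submodule.span ℚ {y k})
    (n : ℕ) (s t : Fin n → ℕ) (hs : StrictMono s) (ht : StrictMono t) (N N' : ℕ)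
    (hN : ∀ i, s i < N) (hN' : ∀ i, t i < N') :
    ∃ Γ : Submodule ℚ (M × M), IsPartialIso e Γ ∧ #Γ < κ ∧ (∀ w ∈ W 0, (w, w) ∈ Γ) ∧
      (∀ i, (y (s i), y (t i)) ∈ Γ) ∧ ∀ p ∈ Γ, p.1 ∈ W N ∧ p.2 ∈ W N' := by
  have hmono : Monotone W := monotone_nat_of_le_succ fun k => by
    rw [(hy k).2]
    exact le_sup_left
  induction n generalizing N N' with
  | zero =>
    refine ⟨diagGraph (W 0), isPartialIso_diagGraph he, mk_diagGraph_lt hW,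
      fun w hw => mk_mem_diagGraph hw, fun i => i.elim0, ?_⟩
    rintro - ⟨w, hw, rfl⟩
    exact ⟨hmono (Nat.zero_le _) hw, hmono (Nat.zero_le _) hw⟩
  | succ n ih =>
    obtain ⟨Γ, h1, h2, h3, h4, h5⟩ := ih (fun i => s i.castSucc) (fun i => t i.castSucc)
      (hs.comp Fin.strictMono_castSucc) (ht.comp Fin.strictMono_castSucc) (s (Fin.last n))
      (t (Fin.last n)) (fun i => hs (Fin.castSucc_lt_last i)) (fun i => ht (Fin.castSucc_lt_last i))
    have hcut := h1.sameCut_of_isAboveInf h5 (hy _).1 (hy _).1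
    refine ⟨_, h1.extend hcut, mk_sup_span_singleton_lt hκ h2 _,
      fun w hw => Submodule.mem_sup_left (h3 w hw), ?_, fun p hp => ?_⟩
    · refine Fin.lastCases ?_ fun i => Submodule.mem_sup_left (h4 i)
      exact Submodule.mem_sup_right (Submodule.mem_span_singleton_self _)
    · obtain ⟨r, hr, q, rfl⟩ := mem_sup_span_singleton_iff.1 hp
      have key : ∀ {x : M} {k K : ℕ}, x ∈ W k → k < K → x + q • y k ∈ W K := fun hx hk =>
        hmono (Nat.succ_le_of_lt hk) (by
          rw [Nat.succ_eq_add_one, (hy _).2]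
          exact mem_sup_span_singleton_iff.2 ⟨_, hx, q, rfl⟩)
      exact ⟨key (h5 r hr).1 (hN _), key (h5 r hr).2 (hN' _)⟩

/-- If `μ` is not contained in `H`, some infinitesimal `x₀` bounds `H ∩ μ`. Choose infinitesimals `y
k`, each above all infinitesimals of the span of `e`, `A`, `x₀` and its predecessors. Stability
exchanges `y 0` and `y 1` modulo `H` in one coordinate and exactly in the other; order preservation
then gives `y 1 ≤ y 0 + x₀`, which is absurd. -/
theorem IsOrderedModel.infSubgroup_le_of_isStableHyper (hO : IsOrderedModel e)
    (hM : IsMonster langAddI M κ) {A : Set M} (hA : #A < κ) {H : AddSubgroup M}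
    (hH : InvariantOver langAddI A (H : Set M))
    (hst : IsStableHyper langAddI κ A (QuotientAddGroup.leftRel H)) : hO.infSubgroup ≤ H := by
  set μ := hO.infSubgroup
  by_contra hnle
  set V := Submodule.span ℚ (insert e A)
  have hV : #V < κ := mk_span_lt hM.aleph0_lt (hM.mk_insert_lt hA e)
  have hsub : insert e A ⊆ (V : Set M) := Submodule.subset_span
  have he : e ∈ V := hsub (Set.mem_insert _ _)
  obtain ⟨x₀, hx₀, hbound⟩ : ∃ x₀ ∈ μ, ∀ h ∈ H, h ∈ μ → h ≤ x₀ := by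
    -- If `H ∩ μ` were unbounded, it would contain some `h` above the infinitesimals of `V`. For `x
    -- ≥ 0` in `μ`, the element `h + x` has the same type over `V`, so `x ∈ H`; thus `μ ≤ H`.
    by_contra! hne
    obtain ⟨y, hy⟩ := hO.exists_isAboveInf hM.saturated he hV
    obtain ⟨h, hhH, hhμ, hhy⟩ := hne y hy.mem
    have hyh : y ≤ h := (hO.total_of_mem_infSubgroup hhμ hy.mem).resolve_left hhy
    have above : ∀ z ∈ μ, h ≤ z → hO.IsAboveInf V z := fun z hz hhz =>
      ⟨hz, fun w hw hwμ => (hy.lt w hw hwμ).trans_le (hyh.trans hhz)⟩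
    have hpos : ∀ x ∈ μ, 0 ≤ x → x ∈ H := by
      intro x hx hx0
      have a1 := above h hhμ le_rfl
      have a2 := above (h + x) (μ.add_mem hhμ hx) (le_add_of_nonneg_right hx0)
      obtain ⟨σ, hσ, hσh⟩ := hO.exists_equiv_fixing hM.aleph0_lt hM.saturated hM.homogeneous he hV
        (y := h) (y' := h + x) fun w hw =>
          ⟨(a1.le_iff hw).trans (a2.le_iff hw).symm, (a1.ge_iff hw).trans (a2.ge_iff hw).symm⟩
      have h1 : h + x ∈ H :=
        hσh ▸ (hH.mem_iff (fun c hc => hσ c (hsub (Or.inr hc))) h).2 hhH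
      exact (H.add_mem_cancel_left hhH).1 h1
    refine hnle fun x hx => ?_
    rcases hO.total_of_mem_infSubgroup hx μ.zero_mem with h0 | h0
    · exact H.neg_mem_iff.1 (hpos (-x) (μ.neg_mem hx) (neg_nonneg.2 h0))
    · exact hpos x hx h0
  obtain ⟨W, y, hW0, hy⟩ := hO.exists_isAboveInf_seq hM (V := V ⊔ Submodule.span ℚ {x₀})
    (Submodule.mem_sup_left he) (mk_sup_span_singleton_lt hM.aleph0_lt hV x₀)
  have hcos : ∀ {σ : M ≃[langAddI] M}, (∀ c ∈ A, σ c = c) → ∀ x y : M,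
      σ '' {m | Quotient.mk (QuotientAddGroup.leftRel H) m = Quotient.mk _ x} =
        {m | Quotient.mk (QuotientAddGroup.leftRel H) m = Quotient.mk _ y} ↔ σ x - y ∈ H :=
    fun hσ => hO.image_coset_eq_iff (hH.mem_iff hσ)
  have hind : IsIndiscernible langAddI A (QuotientAddGroup.leftRel H)
      (fun k => Quotient.mk _ (y k)) (fun k (_ : PUnit.{w + 1}) => y k) := by
    intro n s t hs ht
    obtain ⟨N, hN⟩ := (Set.finite_range s).bddAbove
    obtain ⟨N', hN'⟩ := (Set.finite_range t).bddAbove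
    obtain ⟨Γ, h1, h2, h3, h4, -⟩ := hO.exists_isPartialIso_seq hM.aleph0_lt
      (hW0 ▸ Submodule.mem_sup_left he)
      (hW0 ▸ mk_sup_span_singleton_lt hM.aleph0_lt hV x₀) hy n s t hs ht (N + 1) (N' + 1)
      (fun i => Nat.lt_succ_of_le (hN ⟨i, rfl⟩)) (fun i => Nat.lt_succ_of_le (hN' ⟨i, rfl⟩))
    obtain ⟨σ, hσ⟩ := h1.exists_equiv hO hM.aleph0_lt hM.saturated hM.homogeneous h2
    have hσA : ∀ c ∈ A, σ c = c := fun c hc => hσ _ (h3 c (hW0 ▸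
      Submodule.mem_sup_left (hsub (Or.inr hc))))
    refine ⟨σ, hσA, fun k => (hcos hσA _ _).2 ?_, fun p => hσ _ (h4 p.1)⟩
    rw [hσ _ (h4 k), sub_self]
    exact H.zero_mem
  obtain ⟨σ, hσA, h1, h2⟩ := hst PUnit.{w + 1}
    (by rw [mk_punit]; exact one_lt_aleph0.trans hM.aleph0_lt) _ _ hind 0 1 zero_ne_one
  have h3 : σ (y 0) - y 1 ∈ H := (hcos hσA _ _).1 (h1 ())
  have h4 : σ (y 1) = y 0 := h2 PUnit.unit
  have hW1 : y 0 + x₀ ∈ W 1 := by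
    rw [(hy 0).2, hW0]
    exact Submodule.add_mem _ (Submodule.mem_sup_right (Submodule.mem_span_singleton_self _))
      (Submodule.mem_sup_left (Submodule.mem_sup_right (Submodule.mem_span_singleton_self _)))
  have hy01 : y 0 ≤ y 1 := ((hy 1).1.lt (y 0) (by
    rw [(hy 0).2]
    exact Submodule.mem_sup_right (Submodule.mem_span_singleton_self _)) (hy 0).1.mem).le
  have h5 : σ (y 0) ≤ y 0 := by
    conv_rhs => rw [← h4]
    exact (hO.equiv_le_iff σ).2 hy01
  have h6 : σ (y 0) - y 1 ∈ μ :=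
    μ.sub_mem ((hO.equiv_mem_infSubgroup_iff σ).2 (hy 0).1.mem) (hy 1).1.mem
  have h7 : -(σ (y 0) - y 1) ≤ x₀ := hbound _ (H.neg_mem h3) (μ.neg_mem h6)
  have h8 : y 0 + x₀ < y 1 := (hy 1).1.lt _ hW1 (μ.add_mem (hy 0).1.mem hx₀)
  have h9 : y 1 ≤ σ (y 0) + x₀ := by
    rw [neg_sub, sub_le_iff_le_add'] at h7
    exact h7
  exact absurd (h9.trans (add_le_add_left h5 x₀)) h8.not_ge

end Least

/-! ### NIP and instability -/

section NIP

/-- Elimination of one variable: if the signs of the functionals and of their pairwise resultants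
agree at two points, then every extension of the first point by a coordinate `y` has a
counterpart for the second. -/
theorem exists_sign_iff {ι : Type*} (F : Finset ι) (c s s' : ι → ℝ)
    (h₁ : ∀ f ∈ F, 0 ≤ s f ↔ 0 ≤ s' f)
    (h₂ : ∀ f ∈ F, ∀ g ∈ F, 0 ≤ c f * s g - c g * s f ↔ 0 ≤ c f * s' g - c g * s' f) (y : ℝ) :
    ∃ y', ∀ f ∈ F, 0 ≤ s f + y * c f ↔ 0 ≤ s' f + y' * c f := by
  classical
  set G := F.filter fun f => c f ≠ 0
  have hG : ∀ f ∈ G, f ∈ F ∧ c f ≠ 0 := fun f hf => Finset.mem_filter.1 hf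
  -- The resultants decide the order of the roots in `y`, so the finite patterns of roots at the two
  -- points are isomorphic and `y` can be transported between them.
  have hle : ∀ f ∈ G, ∀ g ∈ G, -s f / c f ≤ -s g / c g ↔ -s' f / c f ≤ -s' g / c g := by
    intro f hf g hg
    have key : ∀ r : ι → ℝ, -r f / c f ≤ -r g / c g ↔
        0 ≤ (c g * r f - c f * r g) / (c f * c g) := fun r => by
      rw [← sub_nonneg, div_sub_div _ _ (hG g hg).2 (hG f hf).2, mul_comm (c g) (c f)]
      ring_nf
    rw [key, key]
    rcases (mul_ne_zero (hG f hf).2 (hG g hg).2).lt_or_gt with hc | hc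
    · have := h₂ f (hG f hf).1 g (hG g hg).1
      rw [← neg_sub, ← neg_sub (c g * s' f), neg_nonneg, neg_nonneg] at this
      rw [le_div_iff_of_neg hc, le_div_iff_of_neg hc, zero_mul, this]
    · rw [le_div_iff₀ hc, le_div_iff₀ hc, zero_mul]
      exact h₂ g (hG g hg).1 f (hG f hf).1
  suffices h : ∃ y', ∀ f ∈ G, (-s f / c f ≤ y ↔ -s' f / c f ≤ y') ∧
      (y ≤ -s f / c f ↔ y' ≤ -s' f / c f) by
    obtain ⟨y', hy'⟩ := h
    refine ⟨y', fun f hf => ?_⟩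
    rcases lt_trichotomy (c f) 0 with hc | hc | hc
    · have h3 := (hy' f (Finset.mem_filter.2 ⟨hf, hc.ne⟩)).2
      rw [le_div_iff_of_neg hc, le_div_iff_of_neg hc] at h3
      constructor <;> intro h4
      · linarith [h3.1 (by linarith)]
      · linarith [h3.2 (by linarith)]
    · simpa [hc] using h₁ f hf
    · have h3 := (hy' f (Finset.mem_filter.2 ⟨hf, hc.ne'⟩)).1
      rw [div_le_iff₀ hc, div_le_iff₀ hc] at h3
      constructor <;> intro h4
      · linarith [h3.1 (by linarith)]
      · linarith [h3.2 (by linarith)]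
  by_cases hy : ∃ f ∈ G, -s f / c f = y
  · obtain ⟨f, hf, rfl⟩ := hy
    exact ⟨_, fun g hg => ⟨hle g hg f hf, hle f hf g hg⟩⟩
  push Not at hy
  obtain ⟨y', h1, h2⟩ := Order.exists_between_finsets
    ((G.filter fun f => -s f / c f < y).image fun f => -s' f / c f)
    ((G.filter fun f => y < -s f / c f).image fun f => -s' f / c f) (by
      simp only [Finset.mem_image, Finset.mem_filter]
      rintro - ⟨f, ⟨hf, hfy⟩, rfl⟩ - ⟨g, ⟨hg, hgy⟩, rfl⟩
      exact lt_of_not_ge fun h => ((hle g hg f hf).2 h).not_gt (hfy.trans hgy))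
  have h1' : ∀ f ∈ G, -s f / c f < y → -s' f / c f < y' := fun f hf h =>
    h1 _ (Finset.mem_image.2 ⟨f, Finset.mem_filter.2 ⟨hf, h⟩, rfl⟩)
  have h2' : ∀ f ∈ G, y < -s f / c f → y' < -s' f / c f := fun f hf h =>
    h2 _ (Finset.mem_image.2 ⟨f, Finset.mem_filter.2 ⟨hf, h⟩, rfl⟩)
  refine ⟨y', fun f hf => ?_⟩
  rcases (hy f hf).lt_or_gt with h | h
  · exact ⟨iff_of_true h.le (h1' f hf h).le, iff_of_false h.not_ge (h1' f hf h).not_ge⟩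
  · exact ⟨iff_of_false h.not_ge (h2' f hf h).not_ge, iff_of_true h.le (h2' f hf h).le⟩

/-- Appending a zero, as a linear map. -/
def snocZero (n : ℕ) : (Fin n → ℝ) →ₗ[ℝ] (Fin (n + 1) → ℝ) where
  toFun xs := Fin.snoc xs 0
  map_add' xs ys := by
    ext i
    refine Fin.lastCases ?_ (fun i => ?_) i <;> simp
  map_smul' r xs := by
    ext i
    refine Fin.lastCases ?_ (fun i => ?_) i <;> simp

theorem exists_linear_term {α : Type*} {n : ℕ} (t : langAddI.Term (α ⊕ Fin n)) :
    ∃ ℓ : ((α → ℝ) × (Fin n → ℝ)) →ₗ[ℝ] ℝ, ∀ v xs, t.realize (Sum.elim v xs) = ℓ (v, xs) := by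
  induction t with
  | var i =>
    rcases i with i | i
    · exact ⟨LinearMap.proj i ∘ₗ LinearMap.fst ℝ _ _, fun v xs => rfl⟩
    · exact ⟨LinearMap.proj i ∘ₗ LinearMap.snd ℝ _ _, fun v xs => rfl⟩
  | func f ts ih =>
    cases f with
    | add =>
      obtain ⟨ℓ₀, h₀⟩ := ih 0
      obtain ⟨ℓ₁, h₁⟩ := ih 1
      refine ⟨ℓ₀ + ℓ₁, fun v xs => ?_⟩
      rw [LinearMap.add_apply, ← h₀, ← h₁]
      rfl

/-- In `(ℝ, +, [0,1])` the truth value of a formula is determined by the signs of finitely many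
affine functionals. -/
theorem exists_finset_affine {α : Type*} {n : ℕ} (φ : langAddI.BoundedFormula α n) :
    ∃ F : Finset ((((α → ℝ) × (Fin n → ℝ)) →ₗ[ℝ] ℝ) × ℝ), ∀ v v' xs xs',
      (∀ f ∈ F, 0 ≤ f.1 (v, xs) + f.2 ↔ 0 ≤ f.1 (v', xs') + f.2) →
      (φ.Realize v xs ↔ φ.Realize v' xs') := by
  classical
  induction φ with
  | falsum => exact ⟨∅, fun _ _ _ _ _ => Iff.rfl⟩
  | equal t₁ t₂ =>
    obtain ⟨ℓ₁, h₁⟩ := exists_linear_term t₁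
    obtain ⟨ℓ₂, h₂⟩ := exists_linear_term t₂
    refine ⟨{(ℓ₁ - ℓ₂, 0), (ℓ₂ - ℓ₁, 0)}, fun v v' xs xs' h => ?_⟩
    simp only [Finset.mem_insert, Finset.mem_singleton, forall_eq_or_imp, forall_eq,
      LinearMap.sub_apply, add_zero, sub_nonneg] at h
    change t₁.realize _ = t₂.realize _ ↔ t₁.realize _ = t₂.realize _
    rw [h₁, h₂, h₁, h₂, le_antisymm_iff, le_antisymm_iff, h.1, h.2]
  | rel R ts =>
    cases R with
    | unit =>
      obtain ⟨ℓ, hℓ⟩ := exists_linear_term (ts 0)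
      refine ⟨{(ℓ, 0), (-ℓ, 1)}, fun v v' xs xs' h => ?_⟩
      simp only [Finset.mem_insert, Finset.mem_singleton, forall_eq_or_imp, forall_eq,
        LinearMap.neg_apply, add_zero, neg_add_eq_sub, sub_nonneg] at h
      change (ts 0).realize _ ∈ Set.Icc (0 : ℝ) 1 ↔ (ts 0).realize _ ∈ Set.Icc (0 : ℝ) 1
      rw [hℓ, hℓ]
      exact and_congr h.1 h.2
  | imp φ ψ ih₁ ih₂ =>
    obtain ⟨F₁, h₁⟩ := ih₁
    obtain ⟨F₂, h₂⟩ := ih₂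
    refine ⟨F₁ ∪ F₂, fun v v' xs xs' h => imp_congr (h₁ v v' xs xs' fun f hf => ?_)
      (h₂ v v' xs xs' fun f hf => ?_)⟩
    · exact h f (Finset.mem_union_left _ hf)
    · exact h f (Finset.mem_union_right _ hf)
  | @all n φ ih =>
    obtain ⟨F, hF⟩ := ih
    -- `r` sets the quantified coordinate to zero and `c` is its coefficient; the new family
    -- consists of the restrictions and all pairwise resultants.
    let r : (((α → ℝ) × (Fin (n + 1) → ℝ)) →ₗ[ℝ] ℝ) → (((α → ℝ) × (Fin n → ℝ)) →ₗ[ℝ] ℝ) :=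
      fun ℓ => ℓ ∘ₗ LinearMap.prodMap LinearMap.id (snocZero n)
    let c : (((α → ℝ) × (Fin (n + 1) → ℝ)) →ₗ[ℝ] ℝ) → ℝ := fun ℓ =>
      ℓ (0, Pi.single (Fin.last n) 1)
    have hr : ∀ ℓ v xs y, ℓ (v, Fin.snoc xs y) = r ℓ (v, xs) + y * c ℓ := by
      intro ℓ v xs y
      have : ((v, Fin.snoc xs y) : (α → ℝ) × (Fin (n + 1) → ℝ)) =
          (v, snocZero n xs) + y • (0, Pi.single (Fin.last n) 1) := by
        refine Prod.ext (by simp) (funext fun i => ?_)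
        refine Fin.lastCases ?_ (fun i => ?_) i <;> simp [snocZero]
      rw [this, map_add, map_smul]
      rfl
    have step : ∀ v v' xs xs',
        (∀ f ∈ F, 0 ≤ r f.1 (v, xs) + f.2 ↔ 0 ≤ r f.1 (v', xs') + f.2) →
        (∀ f ∈ F, ∀ g ∈ F,
          0 ≤ c f.1 * (r g.1 (v, xs) + g.2) - c g.1 * (r f.1 (v, xs) + f.2) ↔
          0 ≤ c f.1 * (r g.1 (v', xs') + g.2) - c g.1 * (r f.1 (v', xs') + f.2)) →
        (∀ y, φ.Realize v' (Fin.snoc xs' y)) → ∀ y, φ.Realize v (Fin.snoc xs y) := by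
      intro v v' xs xs' h₁ h₂ H y
      obtain ⟨y', hy'⟩ := exists_sign_iff F (fun f => c f.1) (fun f => r f.1 (v, xs) + f.2)
        (fun f => r f.1 (v', xs') + f.2) h₁ h₂ y
      refine (hF _ _ _ _ fun f hf => ?_).2 (H y')
      rw [hr, hr, add_right_comm, add_right_comm (r f.1 (v', xs'))]
      exact hy' f hf
    refine ⟨(F.image fun f => (r f.1, f.2)) ∪ ((F ×ˢ F).image fun p =>
      (c p.1.1 • r p.2.1 - c p.2.1 • r p.1.1, c p.1.1 * p.2.2 - c p.2.1 * p.1.2)),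
      fun v v' xs xs' h => ?_⟩
    have h₁ : ∀ f ∈ F, 0 ≤ r f.1 (v, xs) + f.2 ↔ 0 ≤ r f.1 (v', xs') + f.2 := fun f hf =>
      h (r f.1, f.2) (Finset.mem_union_left _ (Finset.mem_image_of_mem _ hf))
    have h₂ : ∀ f ∈ F, ∀ g ∈ F,
          0 ≤ c f.1 * (r g.1 (v, xs) + g.2) - c g.1 * (r f.1 (v, xs) + f.2) ↔
          0 ≤ c f.1 * (r g.1 (v', xs') + g.2) - c g.1 * (r f.1 (v', xs') + f.2) := by
      intro f hf g hg
      have := h _ (Finset.mem_union_right _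
        (Finset.mem_image_of_mem _ (Finset.mk_mem_product hf hg)))
      simp only [LinearMap.sub_apply, LinearMap.smul_apply, smul_eq_mul] at this
      convert this using 2 <;> ring
    exact ⟨step v' v xs' xs (fun f hf => (h₁ f hf).symm) fun f hf g hg => (h₂ f hf g hg).symm,
      step v v' xs xs' h₁ h₂⟩

theorem exists_pow_lt_two_pow (s : ℕ) : ∃ k : ℕ, (k + 1) ^ s < 2 ^ k := by
  have h := tendsto_pow_const_div_const_pow_of_one_lt s (one_lt_two : (1 : ℝ) < 2)
  obtain ⟨n, hn, hn1⟩ := ((h.eventually (gt_mem_nhds (half_pos one_pos))).and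
    (Filter.eventually_ge_atTop 1)).exists
  obtain ⟨k, rfl⟩ := Nat.exists_eq_add_of_le' hn1
  refine ⟨k, ?_⟩
  rw [div_lt_iff₀ (by positivity), pow_succ] at hn
  have : ((k + 1 : ℕ) : ℝ) ^ s < 2 ^ k := by linarith
  exact_mod_cast this

/-- No formula shatters arbitrarily large finite sets in `(ℝ, +, [0,1])`. -/
theorem exists_not_shattered {m n : ℕ} (φ : langAddI.Formula (Fin m ⊕ Fin n)) :
    ∃ k : ℕ, ¬ ∃ (a : Fin k → Fin m → ℝ) (b : Set (Fin k) → Fin n → ℝ),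
      ∀ i S, φ.Realize (Sum.elim (a i) (b S)) ↔ i ∈ S := by
  classical
  obtain ⟨F, hF⟩ := exists_finset_affine φ
  obtain ⟨k, hk⟩ := exists_pow_lt_two_pow F.card
  refine ⟨k, ?_⟩
  rintro ⟨a, b, hab⟩
  let E := ((Fin m ⊕ Fin n → ℝ) × (Fin 0 → ℝ) →ₗ[ℝ] ℝ) × ℝ
  let p : E → Fin k → ℝ := fun f i => f.1 (Sum.elim (a i) fun _ => 0, 0)
  let q : E → Set (Fin k) → ℝ := fun f S => f.1 (Sum.elim (fun _ => 0) (b S), 0) + f.2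
  -- The functional splits into an `a`-part and a `b`-part, so for fixed `f` the traces form a chain
  -- and each is determined by its cardinality. At most `(k + 1) ^ F.card` subsets arise, fewer than
  -- `2 ^ k`.
  let T : E → Set (Fin k) → Finset (Fin k) := fun f S => {i | 0 ≤ p f i + q f S}
  have hval : ∀ (f : E) i S (d : Fin 0 → ℝ),
      f.1 (Sum.elim (a i) (b S), d) + f.2 = p f i + q f S := by
    intro f i S d
    have : ((Sum.elim (a i) (b S), d) : (Fin m ⊕ Fin n → ℝ) × (Fin 0 → ℝ)) =
        (Sum.elim (a i) fun _ => 0, 0) + (Sum.elim (fun _ => 0) (b S), 0) := by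
      refine Prod.ext (funext fun j => ?_) (Subsingleton.elim _ _)
      rcases j with j | j <;> simp
    rw [this, map_add, add_assoc]
  have hinj : Function.Injective fun (S : Set (Fin k)) (f : F) =>
      (⟨(T f.1 S).card, Nat.lt_succ_of_le ((Finset.card_le_univ _).trans_eq (Fintype.card_fin k))⟩ :
        Fin (k + 1)) := by
    intro S S' h
    have hT : ∀ f ∈ F, T f S = T f S' := by
      intro f hf
      have hcard : (T f S).card = (T f S').card := Fin.mk.inj_iff.1 (congrFun h ⟨f, hf⟩)
      have hsub : ∀ {S S' : Set (Fin k)}, q f S ≤ q f S' → T f S ⊆ T f S' := fun hq i hi => by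
        simp only [T, Finset.mem_filter, Finset.mem_univ, true_and] at hi ⊢
        linarith
      rcases le_total (q f S) (q f S') with hq | hq
      · exact Finset.eq_of_subset_of_card_le (hsub hq) hcard.ge
      · exact (Finset.eq_of_subset_of_card_le (hsub hq) hcard.le).symm
    ext i
    rw [← hab, ← hab]
    refine hF _ _ _ _ fun f hf => ?_
    rw [hval, hval]
    have := Finset.ext_iff.1 (hT f hf) i
    simpa [T] using this
  have := Fintype.card_le_of_injective _ hinj
  rw [Fintype.card_set, Fintype.card_fin, Fintype.card_fun, Fintype.card_fin,
    Fintype.card_coe] at this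
  omega

/-- Shattering `k` points is expressed by a single sentence, so a failure of NIP in any model would
transfer to `ℝ` for every `k`. -/
theorem hasNIP_realTheory : HasNIP realTheory := by
  classical
  rintro m n φ N ⟨a, b, hab⟩
  obtain ⟨k, hk⟩ := exists_not_shattered φ
  let γ := (Fin k × Fin m) ⊕ (Set (Fin k) × Fin n)
  let g : Fin k × Set (Fin k) → Fin m ⊕ Fin n → Empty ⊕ γ := fun p =>
    Sum.elim (fun j => Sum.inr (Sum.inl (p.1, j))) (fun j => Sum.inr (Sum.inr (p.2, j)))
  let θ : Fin k × Set (Fin k) → langAddI.Formula (Empty ⊕ γ) := fun p =>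
    if p.1 ∈ p.2 then φ.relabel (g p) else (φ.relabel (g p)).not
  let ψ : langAddI.Sentence := (Formula.iInf θ).iExs γ
  have hψ : ∀ (N : Type) [langAddI.Structure N], N ⊨ ψ ↔
      ∃ (a : Fin k → Fin m → N) (b : Set (Fin k) → Fin n → N),
        ∀ i S, φ.Realize (Sum.elim (a i) (b S)) ↔ i ∈ S := by
    intro N _
    have hθ : ∀ (u : γ → N) (p : Fin k × Set (Fin k)), (θ p).Realize (Sum.elim default u) ↔
        (φ.Realize (Sum.elim (fun j => u (Sum.inl (p.1, j))) fun j => u (Sum.inr (p.2, j))) ↔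
          p.1 ∈ p.2) := by
      intro u p
      have hg : (Sum.elim default u ∘ g p : Fin m ⊕ Fin n → N) =
          Sum.elim (fun j => u (Sum.inl (p.1, j))) fun j => u (Sum.inr (p.2, j)) := by
        ext (j | j) <;> rfl
      by_cases hp : p.1 ∈ p.2
      · simp [θ, hp, Formula.realize_relabel, hg]
      · simp [θ, hp, Formula.realize_relabel, Formula.realize_not, hg]
    have h1 : N ⊨ ψ ↔ ∃ u : γ → N, ∀ p, (θ p).Realize (Sum.elim default u) := by
      rw [Sentence.Realize, Formula.realize_iExs]
      simp only [Formula.realize_iInf]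
    simp only [h1, hθ]
    constructor
    · rintro ⟨u, hu⟩
      exact ⟨fun i j => u (Sum.inl (i, j)), fun S j => u (Sum.inr (S, j)), fun i S => hu (i, S)⟩
    · rintro ⟨a, b, h⟩
      exact ⟨Sum.elim (fun p => a p.1 p.2) (fun p => b p.1 p.2), fun p => h p.1 p.2⟩
  have hN : (N : Type) ⊨ langAddI.completeTheory ℝ := N.is_model
  refine hk ((hψ ℝ).1 ((realize_iff_of_model_completeTheory ℝ N ψ).1 ((hψ N).2
    ⟨fun i => a i, fun S => b (Fin.val '' S), fun i S => ?_⟩)))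
  rw [hab]
  exact Fin.val_injective.mem_set_image

theorem not_isStableTheory_realTheory : ¬ IsStableTheory realTheory := by
  intro h
  have : ℝ ⊨ realTheory := model_completeTheory
  refine h 1 1 (unitFormula (addTerm (var (Sum.inl (Sum.inl 0))) (var (Sum.inl (Sum.inr 0)))))
    (Theory.ModelType.of realTheory ℝ)
    -- `1 / (i + 2) - 1 / (j + 1)` is nonnegative iff `i + 2 ≤ j + 1`; the shift by one makes the
    -- inequality `i < j` strict.
    ⟨fun i _ => (1 / (i + 2) : ℝ), fun j _ => (-(1 / (j + 1)) : ℝ), fun i j => ?_⟩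
  change 0 ≤ (1 / (i + 2) : ℝ) + -(1 / (j + 1)) ∧ (1 / (i + 2) : ℝ) + -(1 / (j + 1)) ≤ 1 ↔ i < j
  have hi : (0 : ℝ) < i + 2 := by positivity
  have hj : (0 : ℝ) < j + 1 := by positivity
  rw [← sub_eq_add_neg, sub_nonneg, one_div_le_one_div hj hi]
  constructor
  · rintro ⟨h1, -⟩
    have : i + 2 ≤ j + 1 := by exact_mod_cast h1
    omega
  · intro h1
    have h2 : (1 / (i + 2) : ℝ) ≤ 1 := by
      rw [div_le_one hi]
      linarith [(Nat.cast_nonneg i : (0 : ℝ) ≤ i)]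
    have h3 : (0 : ℝ) < 1 / (j + 1) := by positivity
    exact ⟨by exact_mod_cast (by omega : i + 2 ≤ j + 1), by linarith⟩

end NIP

end StableQuot

/-! ### The main theorem -/

theorem mainTheorem5 {M : Type w} [langAddI.Structure M] [AddCommGroup M]
    (hadd : ∀ x y : M, Structure.funMap addSymb ![x, y] = x + y)
    (hT : M ⊨ realTheory) (κ : Cardinal.{w}) (hM : IsMonster langAddI M κ) :
    HasNIP realTheory ∧ ¬ IsStableTheory realTheory ∧
    ∃ μ : AddSubgroup M, (μ : Set M) = infinitesimals M ∧
      IsLeast (stableQuotientSubgroups langAddI M κ) μ ∧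
      Gst langAddI M κ = μ ∧
      IsLeast (typeDefinableBoundedSubgroups langAddI M κ) ⊤ ∧
      G0 langAddI M κ = ⊤ ∧ G00 langAddI M κ = ⊤ ∧ G000 langAddI M κ = ⊤ ∧
      Gst0 langAddI M κ = ⊤ ∧
      Gst0 langAddI M κ ≠ Gst langAddI M κ ∧
      Gst langAddI M κ ≠ G00 langAddI M κ ∧
      ¬ ∃ S : Set (AddSubgroup M),
        (∀ H ∈ S, (Set.univ : Set M).Definable₁ langAddI (H : Set M)) ∧
        Gst langAddI M κ = sInf S := by
  obtain ⟨_, _, _, _, e, hO⟩ :=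
    exists_isOrderedModel hadd (isUnitIntervalGroup_of_realTheory hadd hT)
  have hleast : IsLeast (stableQuotientSubgroups langAddI M κ) hO.infSubgroup := by
    refine ⟨⟨∅, ?_, hO.typeDefinable_infSubgroup, hO.isStableHyper_infSubgroup hM⟩, ?_⟩
    · rw [mk_eq_zero]
      exact aleph0_pos.trans hM.aleph0_lt
    · rintro H ⟨A, hA, hH, hst⟩
      exact hO.infSubgroup_le_of_isStableHyper hM hA hH.invariantOver hst
  have hGst : Gst langAddI M κ = hO.infSubgroup := hleast.isGLB.sInf_eq
  have h000 : ∀ H ∈ invariantBoundedSubgroups langAddI M κ, H = ⊤ := by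
    rintro H ⟨⟨A, hA, hH⟩, hi⟩
    exact hO.eq_top_of_invariantOver hM hA hH hi
  have h00 : ∀ H ∈ typeDefinableBoundedSubgroups langAddI M κ, H = ⊤ := by
    rintro H ⟨⟨A, hA, hH⟩, hi⟩
    exact h000 H ⟨⟨A, hA, hH.invariantOver⟩, hi⟩
  have h0 : ∀ H ∈ definableBoundedSubgroups langAddI M κ, H = ⊤ := by
    rintro H ⟨⟨A, hA, hH⟩, hi⟩
    exact h00 H ⟨⟨A, hA, .of_definable hH⟩, hi⟩
  have hst0 : ∀ H ∈ definableStableQuotientSubgroups langAddI M κ, H = ⊤ := by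
    rintro H ⟨A, hA, hH, hst⟩
    exact hO.eq_top_of_definable hM hA hH (hleast.2 ⟨A, hA, .of_definable hH, hst⟩)
  have hG00 : G00 langAddI M κ = ⊤ := sInf_eq_top.2 h00
  have hGst0 : Gst0 langAddI M κ = ⊤ := sInf_eq_top.2 hst0
  have hne := hO.infSubgroup_ne_top
  refine ⟨hasNIP_realTheory, not_isStableTheory_realTheory, hO.infSubgroup, hO.coe_infSubgroup,
    hleast, hGst, ⟨⟨⟨∅, ?_, ?_⟩, ?_⟩, fun H hH => (h00 H hH).ge⟩, sInf_eq_top.2 h0, hG00,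
    sInf_eq_top.2 h000, hGst0, ?_, ?_, ?_⟩
  · rw [mk_eq_zero]
    exact aleph0_pos.trans hM.aleph0_lt
  · exact .of_definable Set.definable_univ
  · have : Subsingleton (M ⧸ (⊤ : AddSubgroup M)) := QuotientAddGroup.subsingleton_quotient_top
    exact (le_one_iff_subsingleton.2 this).trans_lt (one_lt_aleph0.trans hM.aleph0_lt)
  · rw [hGst0, hGst]
    exact hne.symm
  · rw [hG00, hGst]
    exact hne
  · rintro ⟨S, hS, hGS⟩
    rw [hGst] at hGS
    refine hne (hGS.trans (sInf_eq_top.2 fun H hH => ?_))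
    -- Only finitely many parameters occur in a definition, so the parameter set can be taken small.
    -- Each member of the family contains `μ`, hence is the whole group.
    obtain ⟨A, -, hA⟩ := Set.definable_iff_finitely_definable.1 (hS H hH)
    refine hO.eq_top_of_definable hM ?_ hA (hGS ▸ sInf_le hH)
    exact (Cardinal.mk_lt_aleph0_iff.2 A.finite_toSet).trans hM.aleph0_lt
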